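/- Let $(X,d)$ be a complete separable metric space, $\mathcal G(X)\subset C([0,1],X)$ the set of constant speed geodesics $\gamma$, i.e. curves with $d(\gamma_s,\gamma_t)=|s-t|\,d(\gamma_0,\gamma_1)$ for all $s,t\in[0,1]$, with the topology of uniform convergence, and let $e:[0,1]\times\mathcal G(X)\to X$, $e(s,\gamma)=e_s(\gamma)=\gamma_s$. Let $\boldsymbol\gamma$ be an optimal dynamical plan: a Borel probability measure on $\mathcal G(X)$ such that $(e_0,e_1)_\sharp\boldsymbol\gamma$ is an optimal coupling of its marginals for the cost $d^2$ and $t\mapsto\mu_t:=(e_t)_\sharp\boldsymbol\gamma$ is a geodesic in $(\mathcal P_2(X),W_2)$. Let $G=\operatorname{supp}\boldsymbol\gamma$. Let $\varphi$ be a $d^2$-concave Kantorovich potential for $(\mu_0,\mu_1)$, i.e. $\varphi=v^c$ for some $v:X\to\mathbb R\cup\{-\infty\}$, and $(\varphi,\varphi^c)$ is a maximizing pair for the dual Kantorovich problem with cost $d^2/2$, where $\varphi^c(y)=\inf_x\big(\tfrac12d^2(x,y)-\varphi(x)\big)$. For $a\in\mathbb R$ put $$G_a=\{\gamma\in G:\varphi(\gamma_0)=a\},\qquad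 \Gamma_a=\{(x,y)\in X\times X:\varphi(x)+\varphi^c(y)=\tfrac12d^2(x,y),\ \varphi(x)=a\},$$ and let $\phi_a:X\to\mathbb R$ be a $1$-Lipschitz function with $\phi_a(x)-\phi_a(y)=d(x,y)$ for all $(x,y)\in\Gamma_a$. Let $b_0>a_0>b_1>a_1$ be real numbers, let $H\subset G_a$ be such that $(a_0,b_0)\subset\phi_a(\gamma_{(0,1)})$ and $(a_1,b_1)\subset\phi_a(\gamma_{(0,1)})$ for every $\gamma\in H$, and let $\eta$ be a Borel probability measure on $\mathcal G(X)$ for which $H$ is $\eta$-measurable with $\eta(H)=1$. Then the following hold. 1. For every $\gamma\in H$ and $i\in\{0,1\}$ there are unique $R_i^\gamma,L_i^\gamma\in[0,1]$ with $R_i^\gamma+L_i^\gamma\le1$ and $\phi_a\circ\gamma\big((R_i^\gamma,R_i^\gamma+L_i^\gamma)\big)=(a_i,b_i)$. 2. Put $R_t^\gamma=(1-t)R_0^\gamma+tR_1^\gamma$, $L_t^\gamma=(1-t)L_0^\gamma+tL_1^\gamma$ and $$\nu_t=\int_H\frac1{L_t^\gamma}\,\mathcal L^1\llcorner_{[R_t^\gamma,R_t^\gamma+L_t^\gamma]}\,\eta(d\gamma),\qquad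 t\in[0,1],$$ where for each $\gamma$ the measure $\mathcal L^1\llcorner_{[R_t^\gamma,R_t^\gamma+L_t^\gamma]}$ is regarded as a measure on $[0,1]\times\{\gamma\}$. Each $\nu_t$ is a probability measure on $[0,1]\times\mathcal G(X)$ concentrated on $[0,1]\times G_a$. 3. The set $\{(\gamma_{R_0^\gamma+sL_0^\gamma},\gamma_{R_1^\gamma+sL_1^\gamma}):\gamma\in H,\ s\in[0,1]\}$ is $d^2$-cyclically monotone. 4. The curve $[0,1]\ni t\mapsto e_\sharp\nu_t$ is a $W_2$-geodesic of Borel probability measures on $X$: $W_2(e_\sharp\nu_0,e_\sharp\nu_1)<\infty$ and $W_2(e_\sharp\nu_s,e_\sharp\nu_t)=|s-t|\,W_2(e_\sharp\nu_0,e_\sharp\nu_1)$ for all $s,t\in[0,1]$. If $G$ is compact, or if $e_\sharp\nu_t\in\mathcal P_2(X)$ for some $t\in[0,1]$, then $e_\sharp\nu_t\in\mathcal P_2(X)$ for all $t\in[0,1]$, so that the curve is a geodesic in $(\mathcal P_2(X),W_2)$. -/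

import Mathlib

open MeasureTheory Set
open scoped ENNReal

/-- The space `𝒢(X)` of constant speed geodesics `γ : [0,1] → X`, as a subset of `C([0,1], X)`
with the topology of uniform convergence. -/
abbrev Geod (X : Type*) [MetricSpace X] : Type _ :=
  {γ : C(unitInterval, X) //
    ∀ s t : unitInterval, dist (γ s) (γ t) = |(s : ℝ) - (t : ℝ)| * dist (γ 0) (γ 1)}

instance Geod.instMeasurableSpace (X : Type*) [MetricSpace X] : MeasurableSpace (Geod X) :=
  borel (Geod X)

instance Geod.instBorelSpace (X : Type*) [MetricSpace X] : BorelSpace (Geod X) := ⟨rfl⟩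

/-- The evaluation map `e (s, γ) = γ_s`. -/
def evalMap (X : Type*) [MetricSpace X] : unitInterval × Geod X → X :=
  fun p => p.2.1 p.1

section Transport

variable {X : Type*} [MetricSpace X] [MeasurableSpace X]

/-- `Π(μ, ν)`: the couplings (transference plans) of `μ` and `ν`. -/
def Couplings (μ ν : Measure X) : Set (Measure (X × X)) :=
  {π | π.map Prod.fst = μ ∧ π.map Prod.snd = ν}

/-- The cost `∫ d² dπ` of a plan. -/
noncomputable def sqCost (π : Measure (X × X)) : ℝ≥0∞ :=
  ∫⁻ p, edist p.1 p.2 ^ 2 ∂π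

/-- The `L²`-Wasserstein distance, with values in `[0, ∞]`. -/
noncomputable def W2 (μ ν : Measure X) : ℝ≥0∞ :=
  (⨅ π ∈ Couplings μ ν, sqCost π) ^ (1 / 2 : ℝ)

/-- `π` is an optimal coupling of `μ` and `ν` for the cost `d²`. -/
def IsOptimalCoupling (π : Measure (X × X)) (μ ν : Measure X) : Prop :=
  π ∈ Couplings μ ν ∧ ∀ π' ∈ Couplings μ ν, sqCost π ≤ sqCost π'

/-- Finite second moment. -/
def HasFiniteSecondMoment (μ : Measure X) : Prop :=
  ∃ x₀ : X, ∫⁻ x, edist x x₀ ^ 2 ∂μ < ∞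

/-- A (constant speed, minimal) `W₂`-geodesic of Borel probability measures. -/
def IsW2Geodesic (μ : unitInterval → Measure X) : Prop :=
  (∀ t, IsProbabilityMeasure (μ t)) ∧ W2 (μ 0) (μ 1) ≠ ∞ ∧
    ∀ s t : unitInterval,
      W2 (μ s) (μ t) = ENNReal.ofReal |(s : ℝ) - (t : ℝ)| * W2 (μ 0) (μ 1)

/-- A geodesic in `(𝒫₂(X), W₂)`. -/
def IsP2Geodesic (μ : unitInterval → Measure X) : Prop :=
  IsW2Geodesic μ ∧ ∀ t, HasFiniteSecondMoment (μ t)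

/-- An optimal dynamical plan: a probability measure on `𝒢(X)` such that `(e₀, e₁)_♯ P` is an
optimal coupling of its marginals and `t ↦ (e_t)_♯ P` is a geodesic in `(𝒫₂(X), W₂)`. -/
def IsOptimalDynamicalPlan (P : Measure (Geod X)) : Prop :=
  IsProbabilityMeasure P ∧
  IsOptimalCoupling (P.map fun γ => (γ.1 0, γ.1 1)) (P.map fun γ => γ.1 0)
    (P.map fun γ => γ.1 1) ∧
  IsP2Geodesic fun t : unitInterval => P.map fun γ => γ.1 t

/-- The cost `d²(x, y) / 2` as an extended real. -/
noncomputable def halfSq (x y : X) : EReal := ((dist x y ^ 2 / 2 : ℝ) : EReal)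

/-- The `d²`-transform `φᶜ(y) = inf_x (d²(x, y) / 2 - φ(x))`. -/
noncomputable def cTransform (φ : X → EReal) (y : X) : EReal := ⨅ x, (halfSq x y - φ x)

/-- `φ` is `d²`-concave: `φ = vᶜ` for some `v : X → ℝ ∪ {-∞}`. -/
def IsCConcave (φ : X → EReal) : Prop :=
  ∃ v : X → EReal, (∀ x, v x ≠ ⊤) ∧ φ = cTransform v

/-- An extended real valued function in `L¹(μ)`. -/
def EIntegrable (u : X → EReal) (μ : Measure X) : Prop :=
  (∀ᵐ x ∂μ, u x ≠ ⊥ ∧ u x ≠ ⊤) ∧ Integrable (fun x => (u x).toReal) μ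

/-- `(u, v)` is admissible in the dual Kantorovich problem between `μ` and `ν`. -/
def IsDualAdmissible (u v : X → EReal) (μ ν : Measure X) : Prop :=
  EIntegrable u μ ∧ EIntegrable v ν ∧ ∀ x y, u x + v y ≤ halfSq x y

/-- The dual functional `∫ u dμ + ∫ v dν`. -/
noncomputable def dualValue (u v : X → EReal) (μ ν : Measure X) : ℝ :=
  ∫ x, (u x).toReal ∂μ + ∫ y, (v y).toReal ∂ν

/-- `φ` is a `d²`-concave Kantorovich potential for `(μ, ν)`: it is `d²`-concave and `(φ, φᶜ)`
is a maximizing pair for the dual Kantorovich problem. -/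
def IsKantorovichPotential (φ : X → EReal) (μ ν : Measure X) : Prop :=
  IsCConcave φ ∧ IsDualAdmissible φ (cTransform φ) μ ν ∧
    ∀ u v : X → EReal, IsDualAdmissible u v μ ν →
      dualValue u v μ ν ≤ dualValue φ (cTransform φ) μ ν

/-- The geodesics of `G = supp P` starting from the level set `φ⁻¹(a)`. -/
def levelGeod (P : Measure (Geod X)) (φ : X → EReal) (a : ℝ) : Set (Geod X) :=
  {γ | γ ∈ P.support ∧ φ (γ.1 0) = (a : EReal)}

/-- `Γ_a = Γ ∩ (φ⁻¹(a) × X)`, where `Γ = {φ(x) + φᶜ(y) = d²(x, y) / 2}`. -/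
def transportLevelSet (φ : X → EReal) (a : ℝ) : Set (X × X) :=
  {p | φ p.1 + cTransform φ p.2 = halfSq p.1 p.2 ∧ φ p.1 = (a : EReal)}

end Transport

section Curve

variable {X : Type*} [MetricSpace X]

/-- `f` is an `L¹`-Kantorovich potential associated with `Λ ⊆ X × X`: it is `1`-Lipschitz and
`f(x) - f(y) = d(x, y)` on `Λ`. -/
def IsL1Potential (f : X → ℝ) (Λ : Set (X × X)) : Prop :=
  LipschitzWith 1 f ∧ ∀ p ∈ Λ, f p.1 - f p.2 = dist p.1 p.2

/-- `S` is `d²`-cyclically monotone. -/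
def IsSqCyclicallyMonotone (S : Set (X × X)) : Prop :=
  ∀ (n : ℕ) (x y : Fin n → X), (∀ i, (x i, y i) ∈ S) → ∀ σ : Equiv.Perm (Fin n),
    ∑ i, dist (x i) (y i) ^ 2 ≤ ∑ i, dist (x i) (y (σ i)) ^ 2

/-- `(R, R + L) ⊆ [0,1]` is a time interval which `f ∘ γ` maps onto `(a, b)`. -/
def IsTimeWindow (f : X → ℝ) (γ : Geod X) (a b R L : ℝ) : Prop :=
  R ∈ Icc (0 : ℝ) 1 ∧ L ∈ Icc (0 : ℝ) 1 ∧ R + L ≤ 1 ∧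
    (fun τ : unitInterval => f (γ.1 τ)) '' {τ | R < (τ : ℝ) ∧ (τ : ℝ) < R + L} = Ioo a b

/-- Linear interpolation `(1 - t) u + t v`. -/
def interp (t : unitInterval) (u v : ℝ) : ℝ := (1 - (t : ℝ)) * u + (t : ℝ) * v

/-- The measure `(1 / L) 𝓛¹⌞[R, R + L]` on `[0,1] × {γ}`. -/
noncomputable def fiberMeasure (γ : Geod X) (R L : ℝ) : Measure (unitInterval × Geod X) :=
  (ENNReal.ofReal L)⁻¹ •
    ((volume : Measure unitInterval).restrict {τ | R ≤ (τ : ℝ) ∧ (τ : ℝ) ≤ R + L}).map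
      fun τ => (τ, γ)

/-- `ν_t = ∫_H (1 / L_t^γ) 𝓛¹⌞[R_t^γ, R_t^γ + L_t^γ] η(dγ)`, where
`R_t = (1 - t) R₀ + t R₁` and `L_t = (1 - t) L₀ + t L₁`. -/
noncomputable def nuCurve (η : Measure (Geod X)) (H : Set (Geod X)) (R₀ L₀ R₁ L₁ : Geod X → ℝ)
    (t : unitInterval) : Measure (unitInterval × Geod X) :=
  (η.restrict H).bind fun γ =>
    fiberMeasure γ (interp t (R₀ γ) (R₁ γ)) (interp t (L₀ γ) (L₁ γ))

end Curve

/-! The problem reduces to one dimension because `φa` decreases with unit speed along every geodesic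
of `H`. The support of an optimal plan of finite cost is cyclically monotone, so its Rockafellar
potential `ψ` satisfies ψ + ψᶜ = d²/2 there. The dual maximum therefore equals the cost, and any
Kantorovich potential saturates the constraint almost everywhere, hence on all of the support since
the contact set is closed (`IsOptimalDynamicalPlan.mem_contactSet`). Thus φa(γ₀) - φa(γ₁) = d(γ₀,
γ₁) on `H`, and the Lipschitz bounds through γ_t must be equalities.

In the coordinate u = φa(x) the time windows become intervals of levels. The interpolated windows
correspond to the interpolated intervals, whatever the length of γ, so all `ν_t` are images of
Lebesgue measure times `η` (`nuCurve_eq_map`). Between two times the level moves by an increasing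
affine map of intervals, which has explicit quadratic dual potentials F, G
(`exists_quadratic_potentials`).

Since (φa(x) - φa(y))² ≤ d(x, y)², with equality on a single geodesic of `H`, the functions F ∘ φa
and G ∘ φa are dual admissible for d² and saturated on the transported pairs. This yields cyclical
monotonicity, and optimality through `W2_map_eq`. Levels are affine in t, so the displacement
between times s and t is |s - t| times the total one: the curve is a geodesic. -/

/-! ### Optimal plans have cyclically monotone support -/

section Competitor

variable {X : Type*} [MetricSpace X] [TopologicalSpace.SeparableSpace X] [MeasurableSpace X]
  [BorelSpace X]

/-- A common radius such that squared distances between balls around finitely many points are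
nearly constant. -/
theorem exists_radius_sq_dist_near {X : Type*} [MetricSpace X] {n : ℕ} (x y : Fin n → X)
    {ε : ℝ} (hε : 0 < ε) :
    ∃ r > 0, ∀ i j, ∀ z ∈ Metric.ball (x i) r, ∀ w ∈ Metric.ball (y j) r,
      |dist z w ^ 2 - dist (x i) (y j) ^ 2| < ε := by
  have key : ∀ i j, ∀ᶠ r in nhdsWithin (0 : ℝ) (Ioi 0),
      ∀ z ∈ Metric.ball (x i) r, ∀ w ∈ Metric.ball (y j) r,
        |dist z w ^ 2 - dist (x i) (y j) ^ 2| < ε := by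
    intro i j
    have hc : Continuous fun p : X × X => dist p.1 p.2 ^ 2 := by fun_prop
    obtain ⟨δ, hδ, h⟩ := Metric.continuousAt_iff.1 (hc.continuousAt (x := (x i, y j))) ε hε
    filter_upwards [Ioo_mem_nhdsGT hδ] with r hr z hz w hw
    have : dist (z, w) (x i, y j) < δ := by
      rw [Prod.dist_eq]
      exact max_lt (lt_trans hz hr.2) (lt_trans hw hr.2)
    simpa [Real.dist_eq] using h this
  have := (Filter.eventually_all.2 fun i => Filter.eventually_all.2 (key i)).and
    (self_mem_nhdsWithin (a := (0 : ℝ)) (s := Ioi 0))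
  obtain ⟨r, hr, hr0⟩ := this.exists
  exact ⟨r, hr0, hr⟩

/-- If finitely many support points violated the inequality, a little mass near them could be
rerouted along `σ`, keeping the marginals and lowering the cost. Finiteness of the cost allows the
untouched part to be cancelled. -/
theorem IsOptimalCoupling.isSqCyclicallyMonotone_support {π : Measure (X × X)} {μ ν : Measure X}
    [IsFiniteMeasure π] (hπ : IsOptimalCoupling π μ ν) (hfin : sqCost π ≠ ∞) :
    IsSqCyclicallyMonotone π.support := by
  have : SecondCountableTopology X := UniformSpace.secondCountable_of_separable X
  intro n x y hS σ
  by_contra! hlt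
  have hn : 0 < n := by
    rcases Nat.eq_zero_or_pos n with rfl | h
    · simp at hlt
    · exact h
  have hn' : (0 : ℝ) < n := by exact_mod_cast hn
  set gap := ∑ i, dist (x i) (y i) ^ 2 - ∑ i, dist (x i) (y (σ i)) ^ 2 with hgap
  have hgap0 : 0 < gap := by rw [hgap]; linarith
  -- The 2n cost estimates below each lose ε, in total half of the gap.
  obtain ⟨r, hr, hnear⟩ := exists_radius_sq_dist_near x y (ε := gap / (4 * n)) (by positivity)
  set ε := gap / (4 * n)
  have hεn : 4 * (n * ε) = gap := by simp only [ε]; field_simp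
  set A : Fin n → Set (X × X) := fun i => Metric.ball (x i) r ×ˢ Metric.ball (y i) r with hA
  have hAm : ∀ i, MeasurableSet (A i) := fun i => measurableSet_ball.prod measurableSet_ball
  have hApos : ∀ i, 0 < π (A i) := fun i =>
    (Measure.mem_support_iff_forall _).1 (hS i) _
      (prod_mem_nhds (Metric.ball_mem_nhds _ hr) (Metric.ball_mem_nhds _ hr))
  have : Nonempty (Fin n) := ⟨⟨0, hn⟩⟩
  obtain ⟨i₀, hi₀⟩ := Finite.exists_min fun i => π (A i)
  set q : Fin n → Measure (X × X) := fun i => ProbabilityTheory.cond π (A i) with hq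
  have hqp : ∀ i, IsProbabilityMeasure (q i) := fun i =>
    ProbabilityTheory.cond_isProbabilityMeasure (hApos i).ne'
  have : ∀ i, IsProbabilityMeasure ((q i).map Prod.fst) := fun i =>
    Measure.isProbabilityMeasure_map measurable_fst.aemeasurable
  have : ∀ i, IsProbabilityMeasure ((q i).map Prod.snd) := fun i =>
    Measure.isProbabilityMeasure_map measurable_snd.aemeasurable
  have hqA : ∀ i, ∀ᵐ p ∂(q i), p ∈ A i := fun i =>
    ProbabilityTheory.ae_cond_mem (hAm i)
  -- The sets `A i` may overlap. With the smallest mass and the factor 1/n, each `m • q i` is at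
  -- most `π / n`, so their sum `κ` is at most `π`.
  set m : ℝ≥0∞ := (n : ℝ≥0∞)⁻¹ * π (A i₀) with hm
  have hnE : (n : ℝ≥0∞) ≠ 0 := by exact_mod_cast hn.ne'
  have hm0 : m ≠ 0 := mul_ne_zero (by simp) (hApos i₀).ne'
  have hmt : m ≠ ∞ := ENNReal.mul_ne_top (by simpa using hn.ne') (measure_ne_top _ _)
  set κ : Measure (X × X) := m • ∑ i, q i with hκ
  have hκle : κ ≤ π := by
    have h1 : ∀ i, m • q i ≤ (n : ℝ≥0∞)⁻¹ • π := by
      intro i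
      simp only [hq, ProbabilityTheory.cond, hm, smul_smul]
      have : (n : ℝ≥0∞)⁻¹ * π (A i₀) * (π (A i))⁻¹ ≤ (n : ℝ≥0∞)⁻¹ := by
        rw [mul_assoc]
        refine mul_le_of_le_one_right' ?_
        rw [← div_eq_mul_inv]
        exact ENNReal.div_le_of_le_mul (by simpa using hi₀ i)
      refine Measure.le_iff.2 fun s hs => ?_
      simp only [Measure.smul_apply, smul_eq_mul]
      exact mul_le_mul' this (Measure.restrict_apply_le _ _)
    calc κ = ∑ i, m • q i := by rw [hκ, Finset.smul_sum]
      _ ≤ ∑ _i : Fin n, (n : ℝ≥0∞)⁻¹ • π := Finset.sum_le_sum fun i _ => h1 i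
      _ = π := by
        rw [Finset.sum_const, Finset.card_univ, Fintype.card_fin, ← Nat.cast_smul_eq_nsmul ℝ≥0∞,
          smul_smul, ENNReal.mul_inv_cancel hnE (by simp), one_smul]
  have : IsFiniteMeasure κ := isFiniteMeasure_of_le π hκle
  have hdecomp : π - κ + κ = π := Measure.sub_add_cancel_of_le hκle
  set ρ := π - κ
  -- The competitor for `κ`: first marginals are paired independently with the second marginals
  -- permuted by `σ`, so the summed marginals do not change.
  set κ' : Measure (X × X) := m • ∑ i, ((q i).map Prod.fst).prod ((q (σ i)).map Prod.snd) with hκ'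
  have mapsum : ∀ (f : X × X → X) (_ : Measurable f) (θ : Fin n → Measure (X × X)),
      (m • ∑ i, θ i).map f = m • ∑ i, (θ i).map f := by
    intro f hf θ
    rw [Measure.map_smul, ← Measure.mapₗ_apply_of_measurable hf, map_sum]
    simp only [Measure.mapₗ_apply_of_measurable hf]
  have h1 : κ'.map Prod.fst = κ.map Prod.fst := by
    rw [hκ', hκ, mapsum _ measurable_fst, mapsum _ measurable_fst]
    simp
  have h2 : κ'.map Prod.snd = κ.map Prod.snd := by
    rw [hκ', hκ, mapsum _ measurable_snd, mapsum _ measurable_snd]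
    simp only [Measure.map_snd_prod, measure_univ, one_smul]
    rw [Equiv.sum_comp σ fun i => (q i).map Prod.snd]
  have hcoup : ρ + κ' ∈ Couplings μ ν := by
    constructor
    · rw [Measure.map_add _ _ measurable_fst, h1, ← Measure.map_add _ _ measurable_fst, hdecomp]
      exact hπ.1.1
    · rw [Measure.map_add _ _ measurable_snd, h2, ← Measure.map_add _ _ measurable_snd, hdecomp]
      exact hπ.1.2
  have hle := hπ.2 _ hcoup
  have hadd : ∀ α β : Measure (X × X), sqCost (α + β) = sqCost α + sqCost β := fun α β =>
    lintegral_add_measure _ _ _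
  rw [← hdecomp, hadd, hadd] at hle
  have hρ : sqCost ρ ≠ ∞ := by
    rw [← hdecomp, hadd] at hfin
    exact (ENNReal.add_ne_top.1 hfin).1
  have hle' := (ENNReal.add_le_add_iff_left hρ).1 hle
  have hsum : ∀ θ : Fin n → Measure (X × X),
      sqCost (m • ∑ i, θ i) = m * ∑ i, sqCost (θ i) := by
    intro θ
    simp only [sqCost, lintegral_smul_measure, smul_eq_mul]
    rw [lintegral_finsetSum_measure]
  rw [hκ, hκ', hsum, hsum, ENNReal.mul_le_mul_iff_right hm0 hmt] at hle'
  have hed : ∀ a b : X, edist a b ^ 2 = ENNReal.ofReal (dist a b ^ 2) := fun a b => by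
    rw [edist_dist, ENNReal.ofReal_pow dist_nonneg]
  have hlow : ∀ i, ENNReal.ofReal (dist (x i) (y i) ^ 2 - ε) ≤ sqCost (q i) := by
    intro i
    calc ENNReal.ofReal (dist (x i) (y i) ^ 2 - ε)
        = ∫⁻ _, ENNReal.ofReal (dist (x i) (y i) ^ 2 - ε) ∂(q i) := by simp
      _ ≤ _ := by
        refine lintegral_mono_ae ?_
        filter_upwards [hqA i] with p hp
        rw [hed]
        have := (abs_lt.1 (hnear i i p.1 hp.1 p.2 hp.2)).1
        exact ENNReal.ofReal_le_ofReal (by linarith)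
  have hup : ∀ i, sqCost (((q i).map Prod.fst).prod ((q (σ i)).map Prod.snd)) ≤
      ENNReal.ofReal (dist (x i) (y (σ i)) ^ 2 + ε) := by
    intro i
    have hf : ∀ᵐ z ∂((q i).map Prod.fst), z ∈ Metric.ball (x i) r := by
      refine (ae_map_iff measurable_fst.aemeasurable measurableSet_ball).2 ?_
      filter_upwards [hqA i] with p hp using hp.1
    have hs : ∀ᵐ z ∂((q (σ i)).map Prod.snd), z ∈ Metric.ball (y (σ i)) r := by
      refine (ae_map_iff measurable_snd.aemeasurable measurableSet_ball).2 ?_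
      filter_upwards [hqA (σ i)] with p hp using hp.2
    calc _ ≤ ∫⁻ _, ENNReal.ofReal (dist (x i) (y (σ i)) ^ 2 + ε)
          ∂(((q i).map Prod.fst).prod ((q (σ i)).map Prod.snd)) := by
          refine lintegral_mono_ae ?_
          filter_upwards [Measure.quasiMeasurePreserving_fst.ae hf,
            Measure.quasiMeasurePreserving_snd.ae hs] with p hp1 hp2
          rw [hed]
          have := (abs_lt.1 (hnear i (σ i) p.1 hp1 p.2 hp2)).2
          exact ENNReal.ofReal_le_ofReal (by linarith)
      _ = _ := by simp
  have hfinal := (Finset.sum_le_sum fun i _ => hlow i).trans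
    (hle'.trans (Finset.sum_le_sum fun i (_ : i ∈ Finset.univ) => hup i))
  have hε0 : 0 < ε := by simp only [ε]; positivity
  rw [← ENNReal.ofReal_sum_of_nonneg (f := fun i => dist (x i) (y (σ i)) ^ 2 + ε)
    fun i _ => by positivity] at hfinal
  have hfinal2 : ENNReal.ofReal (∑ i, (dist (x i) (y i) ^ 2 - ε)) ≤
      ENNReal.ofReal (∑ i, (dist (x i) (y (σ i)) ^ 2 + ε)) := by
    refine le_trans ?_ hfinal
    exact Finset.le_sum_of_subadditive _ ENNReal.ofReal_zero.le
      (fun _ _ => ENNReal.ofReal_add_le) _ _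
  rw [ENNReal.ofReal_le_ofReal_iff (Finset.sum_nonneg fun i _ => by positivity),
    Finset.sum_sub_distrib, Finset.sum_add_distrib] at hfinal2
  simp only [Finset.sum_const, Finset.card_univ, Fintype.card_fin, nsmul_eq_mul] at hfinal2
  nlinarith [mul_pos hn' hε0]

end Competitor

/-! ### The Rockafellar potential -/

section Potential

variable {X : Type*} [MetricSpace X]

/-- Cyclic monotonicity along a closed chain. -/
theorem IsSqCyclicallyMonotone.sum_range_le {S : Set (X × X)} (hS : IsSqCyclicallyMonotone S)
    (n : ℕ) (p : ℕ → X × X) (hp : ∀ i, p i ∈ S) :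
    ∑ i ∈ Finset.range (n + 1), dist (p i).1 (p i).2 ^ 2 ≤
      ∑ i ∈ Finset.range n, dist (p (i + 1)).1 (p i).2 ^ 2 + dist (p 0).1 (p n).2 ^ 2 := by
  have h := hS (n + 1) (fun i => (p i).1) (fun i => (p i).2) (fun i => hp i)
    (finRotate (n + 1)).symm
  -- Reindexing by the rotation moves the shift onto the first coordinates; the last index wraps
  -- around to 0 and gives the closing term.
  rw [← Equiv.sum_comp (finRotate (n + 1)) fun i : Fin (n + 1) =>
    dist (p i).1 (p ((finRotate (n + 1)).symm i)).2 ^ 2, Fin.sum_univ_castSucc (n := n)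
    (f := fun i : Fin (n + 1) => dist (p (finRotate (n + 1) i)).1
      (p ((finRotate (n + 1)).symm (finRotate (n + 1) i))).2 ^ 2)] at h
  rw [← Fin.sum_univ_eq_sum_range (fun i => dist (p i).1 (p i).2 ^ 2),
    ← Fin.sum_univ_eq_sum_range (fun i => dist (p (i + 1)).1 (p i).2 ^ 2)]
  simp only [Equiv.symm_apply_apply] at h
  simpa using h

/-- The excess cost of a chain of pairs ending at the point `x`. -/
noncomputable def chainCost (n : ℕ) (p : ℕ → X × X) (x : X) : ℝ :=
  ∑ i ∈ Finset.range n, (dist (p (i + 1)).1 (p i).2 ^ 2 / 2 - dist (p i).1 (p i).2 ^ 2 / 2) +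
    (dist x (p n).2 ^ 2 / 2 - dist (p n).1 (p n).2 ^ 2 / 2)

/-- Chains of points of `S` which start from `p₀`. -/
def chains (S : Set (X × X)) (p₀ : X × X) : Set (ℕ → X × X) := {p | p 0 = p₀ ∧ ∀ i, p i ∈ S}

/-- The Rockafellar potential of `S` based at `p₀`. -/
noncomputable def rockafellar (S : Set (X × X)) (p₀ : X × X) (x : X) : EReal :=
  ⨅ (n : ℕ) (p : chains S p₀), ((chainCost n p.1 x : ℝ) : EReal)

/-- A chain ending at `q.1` becomes a chain ending at `x` once `q` is appended. -/
theorem rockafellar_le {S : Set (X × X)} {p₀ : X × X} {q : X × X} (hq : q ∈ S) (x : X) :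
    rockafellar S p₀ x ≤ rockafellar S p₀ q.1 + halfSq x q.2 - halfSq q.1 q.2 := by
  have key : ∀ (n : ℕ) (p : chains S p₀),
      rockafellar S p₀ x - ((dist x q.2 ^ 2 / 2 - dist q.1 q.2 ^ 2 / 2 : ℝ) : EReal) ≤
        ((chainCost n p.1 q.1 : ℝ) : EReal) := by
    rintro n ⟨p, hp0, hp⟩
    set p' : ℕ → X × X := fun i => if i ≤ n then p i else q with hp'
    have hmem : p' ∈ chains S p₀ := by
      refine ⟨by simp [hp', hp0], fun i => ?_⟩
      simp only [hp']
      split_ifs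
      exacts [hp i, hq]
    have hle : rockafellar S p₀ x ≤ ((chainCost (n + 1) p' x : ℝ) : EReal) :=
      (iInf_le _ (n + 1)).trans (iInf_le _ (⟨p', hmem⟩ : chains S p₀))
    have hval : chainCost (n + 1) p' x =
        chainCost n p q.1 + (dist x q.2 ^ 2 / 2 - dist q.1 q.2 ^ 2 / 2) := by
      have hs : ∑ i ∈ Finset.range n, (dist (p' (i + 1)).1 (p' i).2 ^ 2 / 2 -
          dist (p' i).1 (p' i).2 ^ 2 / 2) = ∑ i ∈ Finset.range n,
            (dist (p (i + 1)).1 (p i).2 ^ 2 / 2 - dist (p i).1 (p i).2 ^ 2 / 2) := by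
        refine Finset.sum_congr rfl fun i hi => ?_
        have := Finset.mem_range.1 hi
        simp [hp', this.le, Nat.succ_le_of_lt this]
      simp only [chainCost, Finset.sum_range_succ, hs]
      simp [hp']
    rw [hval, EReal.coe_add] at hle
    exact EReal.sub_le_of_le_add hle
  have := le_iInf fun n => le_iInf (key n)
  change _ ≤ rockafellar S p₀ q.1 at this
  have h2 := (EReal.sub_le_iff_le_add (Or.inl (EReal.coe_ne_bot _))
    (Or.inl (EReal.coe_ne_top _))).1 this
  rw [EReal.coe_sub, ← add_sub_assoc] at h2
  exact h2

/-- A chain returning to its base point is closed, so cyclical monotonicity makes its excess cost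
nonnegative. With `rockafellar_le` this keeps the potential away from -∞ on first coordinates of
`S`. -/
theorem rockafellar_base_nonneg {S : Set (X × X)} (hS : IsSqCyclicallyMonotone S) {p₀ : X × X} :
    0 ≤ rockafellar S p₀ p₀.1 := by
  refine le_iInf fun n => le_iInf ?_
  rintro ⟨p, rfl, hp⟩
  have := hS.sum_range_le n p hp
  rw [Finset.sum_range_succ] at this
  rw [← EReal.coe_zero, EReal.coe_le_coe_iff, chainCost, Finset.sum_sub_distrib,
    ← Finset.sum_div, ← Finset.sum_div]
  linarith

theorem rockafellar_ne_top {S : Set (X × X)} {p₀ : X × X} (hp₀ : p₀ ∈ S) (x : X) :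
    rockafellar S p₀ x ≠ ⊤ := by
  refine ne_top_of_le_ne_top (EReal.coe_ne_top (chainCost 0 (fun _ => p₀) x)) ?_
  exact (iInf_le _ 0).trans (iInf_le _ (⟨fun _ => p₀, rfl, fun _ => hp₀⟩ : chains S p₀))

theorem rockafellar_ne_bot {S : Set (X × X)} (hS : IsSqCyclicallyMonotone S) {p₀ q : X × X}
    (hq : q ∈ S) : rockafellar S p₀ q.1 ≠ ⊥ := by
  intro h
  have h1 := (rockafellar_base_nonneg hS (p₀ := p₀)).trans (rockafellar_le hq p₀.1)
  rw [h, EReal.bot_add, EReal.bot_sub] at h1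
  exact absurd h1 (by simp)

theorem upperSemicontinuous_rockafellar (S : Set (X × X)) (p₀ : X × X) :
    UpperSemicontinuous (rockafellar S p₀) := by
  refine upperSemicontinuous_iInf fun n => upperSemicontinuous_iInf fun p => ?_
  refine Continuous.upperSemicontinuous ?_
  refine continuous_coe_real_ereal.comp ?_
  unfold chainCost
  fun_prop

theorem upperSemicontinuous_cTransform (u : X → EReal) : UpperSemicontinuous (cTransform u) := by
  refine upperSemicontinuous_iInf fun x => Continuous.upperSemicontinuous ?_
  have hc : Continuous fun y : X => (dist x y ^ 2 / 2 : ℝ) := by fun_prop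
  change Continuous fun y => ((dist x y ^ 2 / 2 : ℝ) : EReal) - u x
  -- At infinite values of `u x` the difference is constant in y.
  induction u x with
  | bot => simpa using continuous_const
  | top => simpa using continuous_const
  | coe r =>
    simp_rw [← EReal.coe_sub]
    exact continuous_coe_real_ereal.comp (hc.sub continuous_const)

theorem add_cTransform_le (u : X → EReal) (x y : X) :
    u x + cTransform u y ≤ halfSq x y := by
  have h : cTransform u y ≤ halfSq x y - u x := iInf_le _ x
  by_cases hb : u x = ⊥
  · simp [hb]
  rw [add_comm]
  exact EReal.add_le_of_le_sub h

/-- On a cyclically monotone set, the Rockafellar potential and its transform saturate the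
dual constraint. -/
theorem rockafellar_add_cTransform {S : Set (X × X)} (hS : IsSqCyclicallyMonotone S) {p₀ q : X × X}
    (hp₀ : p₀ ∈ S) (hq : q ∈ S) :
    rockafellar S p₀ q.1 + cTransform (rockafellar S p₀) q.2 = halfSq q.1 q.2 := by
  refine le_antisymm (add_cTransform_le _ _ _) ?_
  obtain ⟨r, hr⟩ : ∃ r : ℝ, rockafellar S p₀ q.1 = r :=
    ⟨_, (EReal.coe_toReal (rockafellar_ne_top hp₀ _) (rockafellar_ne_bot hS hq)).symm⟩
  have : halfSq q.1 q.2 - r ≤ cTransform (rockafellar S p₀) q.2 := by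
    refine le_iInf fun x => ?_
    have h := rockafellar_le (p₀ := p₀) hq x
    rw [hr] at h
    by_cases hb : rockafellar S p₀ x = ⊥
    · rw [hb]; simp [halfSq]
    · rw [← EReal.coe_toReal (rockafellar_ne_top hp₀ x) hb] at h ⊢
      simp only [halfSq] at h ⊢
      norm_cast at h ⊢
      linarith
  rw [hr, add_comm]
  exact EReal.sub_le_iff_le_add (Or.inl (EReal.coe_ne_bot _)) (Or.inl (EReal.coe_ne_top _)) |>.1 this

end Potential

/-! ### Kantorovich potentials saturate the dual constraint -/

section Duality

variable {X : Type*} [MetricSpace X]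

theorem toReal_add_toReal_le {u v : EReal} {r : ℝ} (h : u + v ≤ r) (hu : u ≠ ⊥ ∧ u ≠ ⊤)
    (hv : v ≠ ⊥ ∧ v ≠ ⊤) : u.toReal + v.toReal ≤ r := by
  rw [← EReal.coe_toReal hu.2 hu.1, ← EReal.coe_toReal hv.2 hv.1] at h
  exact_mod_cast h

theorem toReal_add_toReal_eq {u v : EReal} {r : ℝ} (h : u + v = r) :
    (u ≠ ⊥ ∧ u ≠ ⊤) ∧ (v ≠ ⊥ ∧ v ≠ ⊤) ∧ u.toReal + v.toReal = r := by
  induction u <;> induction v <;> simp_all [← EReal.coe_add]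

/-- As `v` avoids +∞, the infimum is +∞ at one point only if `v` is identically -∞, and then it is
+∞ everywhere. -/
theorem IsCConcave.ne_top {φ : X → EReal} (hφ : IsCConcave φ) {x₁ : X} (h₁ : φ x₁ ≠ ⊤) (x : X) :
    φ x ≠ ⊤ := by
  obtain ⟨v, hv, rfl⟩ := hφ
  intro h
  refine h₁ (iInf_eq_top.2 fun z => ?_)
  have hz := iInf_eq_top.1 h z
  have hvz := hv z
  induction hb : v z <;> simp_all [halfSq, ← EReal.coe_sub]

theorem cTransform_ne_top {φ : X → EReal} {x₁ : X} (h₁ : φ x₁ ≠ ⊥) (y : X) :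
    cTransform φ y ≠ ⊤ := by
  intro h
  have h2 := iInf_eq_top.1 h x₁
  induction hb : φ x₁ <;> simp_all [halfSq, ← EReal.coe_sub]

/-- The contact set of a `d²`-concave function is closed. -/
theorem IsCConcave.isClosed_contactSet {φ : X → EReal} (hφ : IsCConcave φ) {x₁ : X}
    (h₁ : φ x₁ ≠ ⊥ ∧ φ x₁ ≠ ⊤) :
    IsClosed {p : X × X | φ p.1 + cTransform φ p.2 = halfSq p.1 p.2} := by
  have husc : UpperSemicontinuous φ := by
    obtain ⟨v, -, rfl⟩ := hφ
    exact upperSemicontinuous_cTransform v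
  -- Addition of extended reals is discontinuous only at opposite infinities, which finiteness of
  -- `φ` at `x₁` excludes.
  have hsum : UpperSemicontinuous fun p : X × X => φ p.1 + cTransform φ p.2 :=
    (husc.comp continuous_fst).add' ((upperSemicontinuous_cTransform φ).comp continuous_snd)
      fun p => EReal.continuousAt_add (Or.inl (hφ.ne_top h₁.2 _))
        (Or.inr (cTransform_ne_top h₁.1 _))
  have hc : Continuous fun p : X × X => (((-(dist p.1 p.2 ^ 2 / 2) : ℝ)) : EReal) :=
    continuous_coe_real_ereal.comp (by fun_prop)
  have hF : UpperSemicontinuous fun p : X × X =>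
      φ p.1 + cTransform φ p.2 + ((-(dist p.1 p.2 ^ 2 / 2) : ℝ) : EReal) :=
    hsum.add' hc.upperSemicontinuous fun p =>
      EReal.continuousAt_add (Or.inr (EReal.coe_ne_bot _)) (Or.inr (EReal.coe_ne_top _))
  convert hF.isClosed_preimage 0 using 1
  ext p
  rw [mem_preimage, mem_Ici, EReal.coe_neg, ← sub_eq_add_neg, EReal.sub_nonneg
    (Or.inr (EReal.coe_ne_top _)) (Or.inr (EReal.coe_ne_bot _))]
  exact ⟨fun h => h.ge, fun h => le_antisymm (add_cTransform_le _ _ _) h⟩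

variable [MeasurableSpace X]

theorem HasFiniteSecondMoment.integrable_sq_dist [OpensMeasurableSpace X] {μ : Measure X}
    [IsFiniteMeasure μ] (h : HasFiniteSecondMoment μ) (z : X) :
    Integrable (fun x => dist x z ^ 2) μ := by
  obtain ⟨x₀, hx₀⟩ := h
  have h0 : Integrable (fun x => dist x x₀ ^ 2) μ := by
    refine ⟨(by fun_prop : Continuous fun x : X => dist x x₀ ^ 2).measurable.aestronglyMeasurable,
      ?_⟩
    refine lt_of_eq_of_lt (lintegral_congr fun x => ?_) hx₀
    rw [edist_dist, ← ENNReal.ofReal_pow dist_nonneg, Real.enorm_eq_ofReal (by positivity)]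
  refine ((h0.const_mul 2).add (integrable_const (2 * dist x₀ z ^ 2))).mono'
    (by fun_prop : Continuous fun x : X => dist x z ^ 2).measurable.aestronglyMeasurable
    (Filter.Eventually.of_forall fun x => ?_)
  rw [Real.norm_of_nonneg (by positivity)]
  have := dist_triangle x x₀ z
  have h1 : dist x z ^ 2 ≤ (dist x x₀ + dist x₀ z) ^ 2 := by gcongr
  simp only [Pi.add_apply]
  nlinarith [sq_nonneg (dist x x₀ - dist x₀ z)]

/-- The Rockafellar pair is admissible and its dual value is the cost ∫ d²/2 dπ. By maximality the
pair (φ, φᶜ) does at least as well, while φ + φᶜ ≤ d²/2 pointwise; equal integrals then force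
equality almost everywhere. -/
theorem IsKantorovichPotential.ae_add_eq [TopologicalSpace.SeparableSpace X] [BorelSpace X]
    {μ ν : Measure X} {φ : X → EReal} (hφ : IsKantorovichPotential φ μ ν)
    {π : Measure (X × X)} [IsProbabilityMeasure π] (hπ : IsOptimalCoupling π μ ν)
    (hfin : sqCost π ≠ ∞) (hμ : HasFiniteSecondMoment μ) (hν : HasFiniteSecondMoment ν) :
    ∀ᵐ p ∂π, φ p.1 + cTransform φ p.2 = halfSq p.1 p.2 := by
  have : SecondCountableTopology X := UniformSpace.secondCountable_of_separable X
  have hS := hπ.isSqCyclicallyMonotone_support hfin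
  obtain ⟨rfl, rfl⟩ := hπ.1
  have : IsProbabilityMeasure (π.map Prod.fst) :=
    Measure.isProbabilityMeasure_map measurable_fst.aemeasurable
  have : IsProbabilityMeasure (π.map Prod.snd) :=
    Measure.isProbabilityMeasure_map measurable_snd.aemeasurable
  have hsupp : ∀ᵐ p ∂π, p ∈ π.support := Measure.support_mem_ae
  obtain ⟨p₀, hp₀⟩ := hsupp.exists
  set ψ := rockafellar π.support p₀
  have hψm : Measurable ψ := (upperSemicontinuous_rockafellar _ _).measurable
  have hcm : Measurable (cTransform ψ) := (upperSemicontinuous_cTransform _).measurable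
  have heq : ∀ p ∈ π.support, ψ p.1 + cTransform ψ p.2 = halfSq p.1 p.2 := fun p hp =>
    rockafellar_add_cTransform hS hp₀ hp
  have hi1 : Integrable (fun p : X × X => dist p.1 p₀.2 ^ 2) π :=
    (hμ.integrable_sq_dist p₀.2).comp_measurable measurable_fst
  have hi2 : Integrable (fun p : X × X => dist p.2 p₀.1 ^ 2) π :=
    (hν.integrable_sq_dist p₀.1).comp_measurable measurable_snd
  set C := |(ψ p₀.1).toReal| + |(cTransform ψ p₀.2).toReal|
  have hbound : ∀ p ∈ π.support,
      |(ψ p.1).toReal| ≤ dist p.1 p₀.2 ^ 2 + dist p.2 p₀.1 ^ 2 + C ∧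
      |(cTransform ψ p.2).toReal| ≤ dist p.1 p₀.2 ^ 2 + dist p.2 p₀.1 ^ 2 + C := by
    intro p hp
    obtain ⟨h1, h2, h3⟩ := toReal_add_toReal_eq (heq p hp)
    obtain ⟨k1, k2, k3⟩ := toReal_add_toReal_eq (heq p₀ hp₀)
    -- Testing `p` against `p₀` bounds both functions from above. Equality at `p`, together with d²
    -- ≥ 0, turns each upper bound into a lower bound for the other function.
    have l1 := toReal_add_toReal_le (add_cTransform_le ψ p.1 p₀.2) h1 k2
    have l2 := toReal_add_toReal_le (add_cTransform_le ψ p₀.1 p.2) k1 h2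
    rw [dist_comm p₀.1] at l2
    have := sq_nonneg (dist p.1 p.2)
    have := sq_nonneg (dist p.1 p₀.2)
    have := sq_nonneg (dist p.2 p₀.1)
    have := neg_abs_le (ψ p₀.1).toReal
    have := neg_abs_le (cTransform ψ p₀.2).toReal
    have := abs_nonneg (ψ p₀.1).toReal
    have := abs_nonneg (cTransform ψ p₀.2).toReal
    simp only [C]
    constructor <;> rw [abs_le] <;> constructor <;> linarith
  have hdom := (hi1.add hi2).add (integrable_const C)
  have hψi : Integrable (fun p : X × X => (ψ p.1).toReal) π := by
    refine hdom.mono' (hψm.comp measurable_fst).ereal_toReal.aestronglyMeasurable ?_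
    filter_upwards [hsupp] with p hp using (hbound p hp).1
  have hci : Integrable (fun p : X × X => (cTransform ψ p.2).toReal) π := by
    refine hdom.mono' (hcm.comp measurable_snd).ereal_toReal.aestronglyMeasurable ?_
    filter_upwards [hsupp] with p hp using (hbound p hp).2
  have hfsm : ∀ {u : X → EReal}, Measurable u → MeasurableSet {x | u x ≠ ⊥ ∧ u x ≠ ⊤} :=
    fun hu => (hu (measurableSet_singleton ⊥).compl).inter (hu (measurableSet_singleton ⊤).compl)
  have hadm : IsDualAdmissible ψ (cTransform ψ) (π.map Prod.fst) (π.map Prod.snd) := by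
    refine ⟨⟨?_, ?_⟩, ⟨?_, ?_⟩, add_cTransform_le ψ⟩
    · refine (ae_map_iff measurable_fst.aemeasurable (hfsm hψm)).2 ?_
      filter_upwards [hsupp] with p hp using (toReal_add_toReal_eq (heq p hp)).1
    · exact (integrable_map_measure hψm.ereal_toReal.aestronglyMeasurable
        measurable_fst.aemeasurable).2 hψi
    · refine (ae_map_iff measurable_snd.aemeasurable (hfsm hcm)).2 ?_
      filter_upwards [hsupp] with p hp using (toReal_add_toReal_eq (heq p hp)).2.1
    · exact (integrable_map_measure hcm.ereal_toReal.aestronglyMeasurable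
        measurable_snd.aemeasurable).2 hci
  have hdual : ∀ u v : X → EReal, IsDualAdmissible u v (π.map Prod.fst) (π.map Prod.snd) →
      Integrable (fun p : X × X => (u p.1).toReal + (v p.2).toReal) π ∧
      dualValue u v (π.map Prod.fst) (π.map Prod.snd) =
        ∫ p, (u p.1).toReal + (v p.2).toReal ∂π := by
    intro u v h
    have j1 := h.1.2.comp_measurable measurable_fst
    have j2 := h.2.1.2.comp_measurable measurable_snd
    refine ⟨j1.add j2, ?_⟩
    rw [dualValue, integral_map measurable_fst.aemeasurable h.1.2.aestronglyMeasurable,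
      integral_map measurable_snd.aemeasurable h.2.1.2.aestronglyMeasurable]
    exact (integral_add j1 j2).symm
  have hmax := hφ.2.2 _ _ hadm
  rw [(hdual _ _ hadm).2, (hdual _ _ hφ.2.1).2] at hmax
  have hψc : (fun p : X × X => (ψ p.1).toReal + (cTransform ψ p.2).toReal) =ᵐ[π]
      fun p => dist p.1 p.2 ^ 2 / 2 := by
    filter_upwards [hsupp] with p hp using (toReal_add_toReal_eq (heq p hp)).2.2
  have hci' : Integrable (fun p : X × X => dist p.1 p.2 ^ 2 / 2) π :=
    (hdual _ _ hadm).1.congr hψc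
  rw [integral_congr_ae hψc] at hmax
  have hfinφ : ∀ᵐ p ∂π, (φ p.1 ≠ ⊥ ∧ φ p.1 ≠ ⊤) ∧ (cTransform φ p.2 ≠ ⊥ ∧ cTransform φ p.2 ≠ ⊤) :=
    (ae_of_ae_map measurable_fst.aemeasurable hφ.2.1.1.1).and
      (ae_of_ae_map measurable_snd.aemeasurable hφ.2.1.2.1.1)
  have hle : (fun p : X × X => (φ p.1).toReal + (cTransform φ p.2).toReal) ≤ᵐ[π]
      fun p => dist p.1 p.2 ^ 2 / 2 := by
    filter_upwards [hfinφ] with p hp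
    exact toReal_add_toReal_le (hφ.2.1.2.2 p.1 p.2) hp.1 hp.2
  have hint := (hdual _ _ hφ.2.1).1
  have hae := (integral_eq_iff_of_ae_le hint hci' hle).1
    (le_antisymm (integral_mono_ae hint hci' hle) hmax)
  filter_upwards [hae, hfinφ] with p hp hf
  rw [halfSq, ← hp, EReal.coe_add, EReal.coe_toReal hf.1.2 hf.1.1, EReal.coe_toReal hf.2.2 hf.2.1]

end Duality

/-- The equality holds almost everywhere and describes a closed set of curves, so it extends to the
whole support. -/
theorem IsOptimalDynamicalPlan.mem_contactSet {X : Type*} [MetricSpace X]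
    [TopologicalSpace.SeparableSpace X] [MeasurableSpace X] [BorelSpace X]
    {P : Measure (Geod X)} (hP : IsOptimalDynamicalPlan P) {φ : X → EReal}
    (hφ : IsKantorovichPotential φ (P.map fun γ => γ.1 0) (P.map fun γ => γ.1 1))
    {γ : Geod X} (hγ : γ ∈ P.support) :
    φ (γ.1 0) + cTransform φ (γ.1 1) = halfSq (γ.1 0) (γ.1 1) := by
  have : SecondCountableTopology X := UniformSpace.secondCountable_of_separable X
  obtain ⟨hprob, hopt, hgeo⟩ := hP
  have he : ∀ t : unitInterval, Continuous fun γ : Geod X => γ.1 t := fun t => by fun_prop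
  have hcont : Continuous fun γ : Geod X => (γ.1 0, γ.1 1) := (he 0).prodMk (he 1)
  have : IsProbabilityMeasure (P.map fun γ => (γ.1 0, γ.1 1)) :=
    Measure.isProbabilityMeasure_map hcont.measurable.aemeasurable
  have hfin : sqCost (P.map fun γ => (γ.1 0, γ.1 1)) ≠ ∞ := by
    have h := hgeo.1.2.1
    intro htop
    refine h ?_
    have : (⨅ π ∈ Couplings (P.map fun γ => γ.1 0) (P.map fun γ => γ.1 1), sqCost π) = ∞ := by
      refine iInf₂_eq_top.2 fun π hπ => top_le_iff.1 ?_
      rw [← htop]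
      exact hopt.2 π hπ
    rw [W2, this, ENNReal.top_rpow_of_pos (by norm_num)]
  have hae := hφ.ae_add_eq hopt hfin (hgeo.2 0) (hgeo.2 1)
  have hae' := ae_of_ae_map hcont.measurable.aemeasurable hae
  have : IsProbabilityMeasure (P.map fun γ => γ.1 0) := hgeo.1.1 0
  obtain ⟨x₁, hx₁⟩ := hφ.2.1.1.1.exists
  exact Measure.support_subset_of_isClosed
    ((hφ.1.isClosed_contactSet hx₁).preimage hcont) hae' hγ

/-! ### Geodesics parametrized by level -/

section LevelTime

variable {X : Type*} [MetricSpace X]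

/-- The Lipschitz bounds on the two pieces of γ add up to the total drop, so neither can be strict.
-/
theorem apply_geod_of_sub_eq_dist {f : X → ℝ} (hf : LipschitzWith 1 f) {γ : Geod X}
    (h : f (γ.1 0) - f (γ.1 1) = dist (γ.1 0) (γ.1 1)) (t : unitInterval) :
    f (γ.1 t) = f (γ.1 0) - t * dist (γ.1 0) (γ.1 1) := by
  have h1 := (le_abs_self _).trans (hf.dist_le_mul (γ.1 0) (γ.1 t))
  have h2 := (le_abs_self _).trans (hf.dist_le_mul (γ.1 t) (γ.1 1))
  rw [γ.2 0 t, Set.Icc.coe_zero, zero_sub, abs_neg, abs_of_nonneg t.2.1, NNReal.coe_one,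
    one_mul] at h1
  rw [γ.2 t 1, Set.Icc.coe_one, abs_sub_comm, abs_of_nonneg (sub_nonneg.2 t.2.2), NNReal.coe_one,
    one_mul] at h2
  linarith

/-- The time at which `f`, decreasing with unit speed along `γ`, takes the value `u`. -/
noncomputable def levelTime (f : X → ℝ) (γ : Geod X) (u : ℝ) : unitInterval :=
  projIcc 0 1 zero_le_one ((f (γ.1 0) - u) / dist (γ.1 0) (γ.1 1))

/-- `f` decreases with unit speed along `γ`, from above `b` to below `a`. -/
structure Crosses (f : X → ℝ) (γ : Geod X) (a b : ℝ) : Prop where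
  apply_eq : ∀ t : unitInterval, f (γ.1 t) = f (γ.1 0) - t * dist (γ.1 0) (γ.1 1)
  dist_pos : 0 < dist (γ.1 0) (γ.1 1)
  le_start : b ≤ f (γ.1 0)
  end_le : f (γ.1 0) - dist (γ.1 0) (γ.1 1) ≤ a

variable {f : X → ℝ} {γ : Geod X} {a b : ℝ}

theorem crosses_of_Ioo_subset (hab : a < b)
    (happ : ∀ t : unitInterval, f (γ.1 t) = f (γ.1 0) - t * dist (γ.1 0) (γ.1 1))
    (hsub : Ioo a b ⊆ (fun τ : unitInterval => f (γ.1 τ)) '' Ioo 0 1) : Crosses f γ a b := by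
  have hpos : 0 < dist (γ.1 0) (γ.1 1) := by
    refine dist_nonneg.lt_of_ne' fun h0 => ?_
    -- On a constant geodesic `f` could not take two distinct values.
    obtain ⟨t, -, ht⟩ := hsub (show (2 * a + b) / 3 ∈ Ioo a b by constructor <;> linarith)
    obtain ⟨t', -, ht'⟩ := hsub (show (a + 2 * b) / 3 ∈ Ioo a b by constructor <;> linarith)
    simp only [happ t, happ t', h0] at ht ht'
    linarith
  have hsub' : Ioo a b ⊆ Ioo (f (γ.1 0) - dist (γ.1 0) (γ.1 1)) (f (γ.1 0)) := by
    intro u hu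
    obtain ⟨t, ⟨ht0, ht1⟩, rfl⟩ := hsub hu
    have ht0 : (0 : ℝ) < t := ht0
    have ht1 : (t : ℝ) < 1 := ht1
    simp only [happ t]
    constructor <;> nlinarith
  obtain ⟨h1, h2⟩ := (Ioo_subset_Ioo_iff hab).1 hsub'
  exact ⟨happ, hpos, h2, h1⟩

theorem Crosses.coe_levelTime (h : Crosses f γ a b) {u : ℝ} (hu : u ∈ Icc a b) :
    (levelTime f γ u : ℝ) = (f (γ.1 0) - u) / dist (γ.1 0) (γ.1 1) := by
  have hm : (f (γ.1 0) - u) / dist (γ.1 0) (γ.1 1) ∈ Icc (0 : ℝ) 1 := by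
    refine ⟨div_nonneg ?_ h.dist_pos.le, (div_le_one h.dist_pos).2 ?_⟩
    · linarith [h.le_start, hu.2]
    · linarith [h.end_le, hu.1]
  rw [levelTime, projIcc_of_mem _ hm]

theorem Crosses.apply_levelTime (h : Crosses f γ a b) {u : ℝ} (hu : u ∈ Icc a b) :
    f (γ.1 (levelTime f γ u)) = u := by
  rw [h.apply_eq, h.coe_levelTime hu, div_mul_cancel₀ _ h.dist_pos.ne']
  ring

theorem Crosses.dist_levelTime (h : Crosses f γ a b) {u v : ℝ} (hu : u ∈ Icc a b)
    (hv : v ∈ Icc a b) : dist (γ.1 (levelTime f γ u)) (γ.1 (levelTime f γ v)) = |u - v| := by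
  rw [γ.2, h.coe_levelTime hu, h.coe_levelTime hv, ← sub_div, abs_div,
    abs_of_pos h.dist_pos, div_mul_cancel₀ _ h.dist_pos.ne', abs_sub_comm]
  congr 1
  ring

/-- Since `f ∘ γ` is affine and decreasing, the window starts at the upper level `b`, and interval
endpoints determine `R` and `L`. -/
theorem Crosses.isTimeWindow_iff (h : Crosses f γ a b) (hab : a < b) {R L : ℝ} :
    IsTimeWindow f γ a b R L ↔
      R = (f (γ.1 0) - b) / dist (γ.1 0) (γ.1 1) ∧ L = (b - a) / dist (γ.1 0) (γ.1 1) := by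
  have hl := h.dist_pos
  have him : 0 ≤ R → R + L ≤ 1 →
      (fun τ : unitInterval => f (γ.1 τ)) '' {τ | R < (τ : ℝ) ∧ (τ : ℝ) < R + L} =
        Ioo (f (γ.1 0) - (R + L) * dist (γ.1 0) (γ.1 1))
          (f (γ.1 0) - R * dist (γ.1 0) (γ.1 1)) := by
    intro hR hRL
    ext u
    constructor
    · rintro ⟨t, ⟨h1, h2⟩, rfl⟩
      simp only [h.apply_eq t]
      constructor <;> nlinarith
    · rintro ⟨h1, h2⟩
      have e1 : R < (f (γ.1 0) - u) / dist (γ.1 0) (γ.1 1) := by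
        rw [lt_div_iff₀ hl]; linarith
      have e2 : (f (γ.1 0) - u) / dist (γ.1 0) (γ.1 1) < R + L := by
        rw [div_lt_iff₀ hl]; linarith
      refine ⟨⟨_, ⟨by linarith, by linarith⟩⟩, ⟨e1, e2⟩, ?_⟩
      change f (γ.1 _) = u
      rw [h.apply_eq]
      field_simp
      ring
  constructor
  · rintro ⟨hR, hL, hRL, heq⟩
    rw [him hR.1 hRL] at heq
    have hne : (Ioo (f (γ.1 0) - (R + L) * dist (γ.1 0) (γ.1 1))
          (f (γ.1 0) - R * dist (γ.1 0) (γ.1 1))).Nonempty := heq ▸ nonempty_Ioo.2 hab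
    obtain ⟨h1, h2⟩ := (Ioo_subset_Ioo_iff (nonempty_Ioo.1 hne)).1 heq.subset
    obtain ⟨h3, h4⟩ := (Ioo_subset_Ioo_iff hab).1 heq.superset
    rw [eq_div_iff hl.ne', eq_div_iff hl.ne']
    constructor <;> linarith
  · rintro ⟨rfl, rfl⟩
    have h1 := h.le_start
    have h2 := h.end_le
    have hR : 0 ≤ (f (γ.1 0) - b) / dist (γ.1 0) (γ.1 1) := div_nonneg (by linarith) hl.le
    have hL : 0 ≤ (b - a) / dist (γ.1 0) (γ.1 1) := div_nonneg (by linarith) hl.le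
    have hRL : (f (γ.1 0) - b) / dist (γ.1 0) (γ.1 1) + (b - a) / dist (γ.1 0) (γ.1 1) ≤ 1 := by
      rw [← add_div, div_le_one hl]; linarith
    refine ⟨⟨hR, by linarith⟩, ⟨hL, by linarith⟩, hRL, ?_⟩
    rw [him hR hRL, ← add_div, div_mul_cancel₀ _ hl.ne', div_mul_cancel₀ _ hl.ne']
    congr 1 <;> ring

theorem Crosses.existsUnique_isTimeWindow (h : Crosses f γ a b) (hab : a < b) :
    ∃! p : ℝ × ℝ, IsTimeWindow f γ a b p.1 p.2 :=
  ⟨(_, _), (h.isTimeWindow_iff hab).2 ⟨rfl, rfl⟩,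
    fun _ hp => Prod.ext ((h.isTimeWindow_iff hab).1 hp).1 ((h.isTimeWindow_iff hab).1 hp).2⟩

end LevelTime

/-! ### Normalized Lebesgue measure on a window as an affine image -/

section Reparametrization

variable {X : Type*} [MetricSpace X]

theorem volume_map_affine {R L : ℝ} (hL : 0 < L) :
    ((volume : Measure ℝ).restrict (Icc 0 1)).map (fun x => R + x * L) =
      (ENNReal.ofReal L)⁻¹ • (volume : Measure ℝ).restrict (Icc R (R + L)) := by
  have hg : Measurable fun x : ℝ => R + x * L := by fun_prop
  have hpre : (fun x : ℝ => R + x * L) ⁻¹' Icc R (R + L) = Icc 0 1 := by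
    ext x
    simp only [mem_preimage, mem_Icc]
    constructor <;> rintro ⟨h1, h2⟩ <;> constructor <;> nlinarith
  rw [← hpre, ← Measure.restrict_map hg measurableSet_Icc]
  have : (volume : Measure ℝ).map (fun x => R + x * L) = (ENNReal.ofReal L)⁻¹ • volume := by
    have h1 : (fun x : ℝ => R + x * L) = (fun x => R + x) ∘ (fun x => x * L) := rfl
    rw [h1, ← Measure.map_map (by fun_prop) (by fun_prop), Real.map_volume_mul_right hL.ne',
      Measure.map_smul, map_add_left_eq_self, abs_of_pos (inv_pos.2 hL),
      ENNReal.ofReal_inv_of_pos hL]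
  rw [this, Measure.restrict_smul]

theorem unitInterval_volume_map_affine {R L : ℝ} (hR : 0 ≤ R) (hL : 0 < L) (hRL : R + L ≤ 1) :
    (volume : Measure unitInterval).map
        (fun s : unitInterval => projIcc (0 : ℝ) 1 zero_le_one (R + s * L)) =
      (ENNReal.ofReal L)⁻¹ •
        (volume : Measure unitInterval).restrict {τ | R ≤ (τ : ℝ) ∧ (τ : ℝ) ≤ R + L} := by
  have hemb : MeasurableEmbedding (Subtype.val : unitInterval → ℝ) :=
    MeasurableEmbedding.subtype_coe measurableSet_Icc
  have hvol : (volume : Measure unitInterval).map Subtype.val =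
      (volume : Measure ℝ).restrict (Icc 0 1) := map_comap_subtype_coe measurableSet_Icc _
  have hproj : Measurable fun s : unitInterval => projIcc (0 : ℝ) 1 zero_le_one (R + s * L) :=
    (continuous_projIcc.comp (by fun_prop)).measurable
  -- The comparison takes place in ℝ: a measure on [0,1] is recovered from its image under the
  -- embedding.
  rw [← hemb.comap_map (Measure.map _ _), ← hemb.comap_map (_ • _)]
  congr 1
  rw [Measure.map_map hemb.measurable hproj, Measure.map_smul]
  have h1 : (Subtype.val ∘ fun s : unitInterval => projIcc (0 : ℝ) 1 zero_le_one (R + s * L)) =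
      (fun x => R + x * L) ∘ Subtype.val := by
    ext s
    have hs := s.2
    have : R + s * L ∈ Icc (0 : ℝ) 1 := ⟨by nlinarith [hs.1], by nlinarith [hs.2]⟩
    simp [projIcc_of_mem _ this]
  have h2 : {τ : unitInterval | R ≤ (τ : ℝ) ∧ (τ : ℝ) ≤ R + L} =
      Subtype.val ⁻¹' (Icc R (R + L)) := rfl
  rw [h1, ← Measure.map_map (by fun_prop) hemb.measurable, hvol, volume_map_affine hL, h2,
    ← hemb.restrict_map, hvol, Measure.restrict_restrict measurableSet_Icc,
    inter_eq_left.2 (Icc_subset_Icc hR hRL)]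

theorem fiberMeasure_eq_map (γ : Geod X) {R L : ℝ} (hR : 0 ≤ R) (hL : 0 < L) (hRL : R + L ≤ 1) :
    fiberMeasure γ R L = (volume : Measure unitInterval).map
      (fun s : unitInterval => (projIcc (0 : ℝ) 1 zero_le_one (R + s * L), γ)) := by
  have hproj : Measurable fun s : unitInterval => projIcc (0 : ℝ) 1 zero_le_one (R + s * L) :=
    (continuous_projIcc.comp (by fun_prop)).measurable
  rw [fiberMeasure, ← Measure.map_smul, ← unitInterval_volume_map_affine hR hL hRL,
    Measure.map_map (by fun_prop) hproj]
  rfl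

theorem bind_map_prodMk {α β δ : Type*} [MeasurableSpace α] [MeasurableSpace β]
    [MeasurableSpace δ] {μ : Measure α} [SFinite μ] {η : Measure β} [SFinite η] {Φ : α × β → δ}
    (hΦ : Measurable Φ) :
    (η.bind fun y => μ.map fun x => Φ (x, y)) = (μ.prod η).map Φ := by
  have hm : Measurable fun y => μ.map fun x => Φ (x, y) := by
    refine Measure.measurable_of_measurable_coe _ fun s hs => ?_
    have : (fun y => (μ.map fun x => Φ (x, y)) s) =
        fun y => μ ((fun x => (x, y)) ⁻¹' (Φ ⁻¹' s)) := by
      ext y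
      exact Measure.map_apply (hΦ.comp measurable_prodMk_right) hs
    rw [this]
    exact measurable_measure_prodMk_right (hΦ hs)
  ext s hs
  rw [Measure.bind_apply hs hm.aemeasurable, Measure.map_apply hΦ hs,
    Measure.prod_apply_symm (hΦ hs)]
  refine lintegral_congr fun y => ?_
  exact Measure.map_apply (hΦ.comp measurable_prodMk_right) hs

end Reparametrization

/-! ### Optimality from dual potentials -/

section Optimality

variable {X : Type*} [MetricSpace X] [TopologicalSpace.SeparableSpace X] [MeasurableSpace X]
  [BorelSpace X]

/-- A coupling which saturates a pair of integrable dual potentials is optimal. -/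
theorem W2_map_eq {Ω : Type*} [MeasurableSpace Ω] {ℙ : Measure Ω} {E E' : Ω → X}
    (hE : Measurable E) (hE' : Measurable E') {F G : X → ℝ} (hF : Measurable F) (hG : Measurable G)
    (hle : ∀ x y, F x + G y ≤ dist x y ^ 2)
    (heq : ∀ᵐ ω ∂ℙ, F (E ω) + G (E' ω) = dist (E ω) (E' ω) ^ 2)
    (hFi : Integrable (fun ω => F (E ω)) ℙ) (hGi : Integrable (fun ω => G (E' ω)) ℙ) :
    W2 (ℙ.map E) (ℙ.map E') = (∫⁻ ω, edist (E ω) (E' ω) ^ 2 ∂ℙ) ^ (1 / 2 : ℝ) := by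
  have : SecondCountableTopology X := UniformSpace.secondCountable_of_separable X
  have hed : ∀ a b : X, edist a b ^ 2 = ENNReal.ofReal (dist a b ^ 2) := fun a b => by
    rw [edist_dist, ENNReal.ofReal_pow dist_nonneg]
  have hdm : Measurable fun p : X × X => dist p.1 p.2 ^ 2 := by fun_prop
  have hpm : Measurable fun ω => (E ω, E' ω) := hE.prodMk hE'
  rw [W2]
  congr 1
  apply le_antisymm
  · have hc : ℙ.map (fun ω => (E ω, E' ω)) ∈ Couplings (ℙ.map E) (ℙ.map E') :=
      ⟨by rw [Measure.map_map measurable_fst hpm]; rfl,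
        by rw [Measure.map_map measurable_snd hpm]; rfl⟩
    refine (iInf₂_le _ hc).trans_eq ?_
    rw [sqCost, lintegral_map (by fun_prop) hpm]
  · refine le_iInf₂ fun π hπ => ?_
    by_cases hfin : sqCost π = ∞
    · rw [hfin]; exact le_top
    have hFπ : Integrable (fun p : X × X => F p.1) π := by
      have : Integrable F (π.map Prod.fst) := by
        rw [hπ.1]
        exact (integrable_map_measure hF.aestronglyMeasurable hE.aemeasurable).2 hFi
      exact this.comp_measurable measurable_fst
    have hGπ : Integrable (fun p : X × X => G p.2) π := by
      have : Integrable G (π.map Prod.snd) := by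
        rw [hπ.2]
        exact (integrable_map_measure hG.aestronglyMeasurable hE'.aemeasurable).2 hGi
      exact this.comp_measurable measurable_snd
    have hF1 : ∫ p, F p.1 ∂π = ∫ ω, F (E ω) ∂ℙ := by
      rw [← integral_map (φ := Prod.fst) measurable_fst.aemeasurable hF.aestronglyMeasurable, hπ.1,
        integral_map hE.aemeasurable hF.aestronglyMeasurable]
    have hG1 : ∫ p, G p.2 ∂π = ∫ ω, G (E' ω) ∂ℙ := by
      rw [← integral_map (φ := Prod.snd) measurable_snd.aemeasurable hG.aestronglyMeasurable, hπ.2,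
        integral_map hE'.aemeasurable hG.aestronglyMeasurable]
    have hdi : Integrable (fun p : X × X => dist p.1 p.2 ^ 2) π := by
      refine ⟨hdm.aestronglyMeasurable, lt_of_eq_of_lt (lintegral_congr fun p => ?_)
        (lt_top_iff_ne_top.2 hfin)⟩
      rw [hed, Real.enorm_eq_ofReal (by positivity)]
    have hdℙ : Integrable (fun ω => dist (E ω) (E' ω) ^ 2) ℙ := (hFi.add hGi).congr heq
    simp only [sqCost, hed]
    rw [← ofReal_integral_eq_lintegral_ofReal hdi (ae_of_all _ fun _ => by positivity),
      ← ofReal_integral_eq_lintegral_ofReal hdℙ (ae_of_all _ fun _ => by positivity),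
      ← integral_congr_ae heq, integral_add hFi hGi, ← hF1, ← hG1, ← integral_add hFπ hGπ]
    exact ENNReal.ofReal_le_ofReal
      (integral_mono (hFπ.add hGπ) hdi fun p => hle p.1 p.2)

/-- Quadratic dual potentials between the uniform distributions on two intervals. -/
theorem exists_quadratic_potentials (B B' : ℝ) {l l' : ℝ} (hl : 0 < l) (hl' : 0 < l') :
    ∃ F G : ℝ → ℝ, Continuous F ∧ Continuous G ∧ (∀ u v, F u + G v ≤ (u - v) ^ 2) ∧
      ∀ σ, F (B - σ * l) + G (B' - σ * l') = ((B - σ * l) - (B' - σ * l')) ^ 2 := by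
  refine ⟨fun u => (B - B') ^ 2 - 2 * (B - B') * (B - u) + (B - u) ^ 2 - l' / l * (B - u) ^ 2,
    fun v => 2 * (B - B') * (B' - v) + (B' - v) ^ 2 - l / l' * (B' - v) ^ 2, by fun_prop,
    by fun_prop, fun u v => ?_, fun σ => ?_⟩
  · have h : l' / l * (B - u) ^ 2 + l / l' * (B' - v) ^ 2 - 2 * (B - u) * (B' - v) =
        (l' * (B - u) - l * (B' - v)) ^ 2 / (l * l') := by
      field_simp
      ring
    have h2 : 0 ≤ (l' * (B - u) - l * (B' - v)) ^ 2 / (l * l') := by positivity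
    nlinarith
  · field_simp
    ring

end Optimality

/-! ### Interpolation of levels -/

section Interpolation

variable {X : Type*} [MetricSpace X]

/-- The level reached at relative time `s` in the interpolation at time `t` between the intervals
`(a₀, b₀)` and `(a₁, b₁)`, both run through downwards. -/
def levelAt (a₀ b₀ a₁ b₁ : ℝ) (t : unitInterval) (s : ℝ) : ℝ :=
  interp t b₀ b₁ - s * (interp t b₀ b₁ - interp t a₀ a₁)

theorem levelAt_sub (a₀ b₀ a₁ b₁ : ℝ) (s t : unitInterval) (r : ℝ) :
    levelAt a₀ b₀ a₁ b₁ s r - levelAt a₀ b₀ a₁ b₁ t r =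
      ((t : ℝ) - s) * (levelAt a₀ b₀ a₁ b₁ 0 r - levelAt a₀ b₀ a₁ b₁ 1 r) := by
  simp only [levelAt, interp, Icc.coe_zero, Icc.coe_one]
  ring

theorem interp_mono {u v u' v' : ℝ} (h : u ≤ u') (h' : v ≤ v') (t : unitInterval) :
    interp t u v ≤ interp t u' v' :=
  add_le_add (mul_le_mul_of_nonneg_left h (sub_nonneg.2 t.2.2))
    (mul_le_mul_of_nonneg_left h' t.2.1)

theorem interp_self (u : ℝ) (t : unitInterval) : interp t u u = u := by
  simp only [interp]
  ring

theorem interp_lt_interp {u v u' v' : ℝ} (h : u < u') (h' : v < v') (t : unitInterval) :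
    interp t u v < interp t u' v' := by
  have ht := t.2
  simp only [interp]
  rcases ht.1.eq_or_lt with h0 | h0
  · rw [← h0]; linarith
  · nlinarith [mul_le_mul_of_nonneg_left h.le (sub_nonneg.2 ht.2), mul_lt_mul_of_pos_left h' h0]

variable {a₀ b₀ a₁ b₁ : ℝ}

theorem levelAt_mem_Icc (h₀ : a₀ < b₀) (h₁₀ : b₁ < a₀) (h₁ : a₁ < b₁) (t s : unitInterval) :
    levelAt a₀ b₀ a₁ b₁ t s ∈ Icc a₁ b₀ := by
  have h := (interp_lt_interp h₀ h₁ t).le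
  have hl := interp_mono (h₁.le.trans h₁₀.le) le_rfl t (u := a₁) (v := a₁) (u' := a₀)
  have hu := interp_mono le_rfl (h₁₀.le.trans h₀.le) t (u := b₀) (v := b₁) (v' := b₀)
  rw [interp_self] at hl hu
  have hs := s.2
  simp only [levelAt, mem_Icc]
  constructor <;> nlinarith [hs.1, hs.2]

/-- The transported point with relative time `s`, at time `t`, together with its geodesic. -/
noncomputable def levelMap (f : X → ℝ) (a₀ b₀ a₁ b₁ : ℝ) (t : unitInterval)
    (p : unitInterval × Geod X) : unitInterval × Geod X :=
  (levelTime f p.2 (levelAt a₀ b₀ a₁ b₁ t p.1), p.2)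

/-- The point of `γ` at the level `levelAt a₀ b₀ a₁ b₁ t s`. -/
noncomputable def levelEval (f : X → ℝ) (a₀ b₀ a₁ b₁ : ℝ) (t : unitInterval)
    (p : unitInterval × Geod X) : X :=
  evalMap X (levelMap f a₀ b₀ a₁ b₁ t p)

theorem Crosses.dist_levelEval {f : X → ℝ} {γ : Geod X} (h : Crosses f γ a₁ b₀)
    (h₀ : a₀ < b₀) (h₁₀ : b₁ < a₀) (h₁ : a₁ < b₁) (r s t : unitInterval) :
    dist (levelEval f a₀ b₀ a₁ b₁ s (r, γ)) (levelEval f a₀ b₀ a₁ b₁ t (r, γ)) =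
      |levelAt a₀ b₀ a₁ b₁ s r - levelAt a₀ b₀ a₁ b₁ t r| :=
  h.dist_levelTime (levelAt_mem_Icc h₀ h₁₀ h₁ s r) (levelAt_mem_Icc h₀ h₁₀ h₁ t r)

theorem Crosses.edist_levelEval {f : X → ℝ} {γ : Geod X} (h : Crosses f γ a₁ b₀)
    (h₀ : a₀ < b₀) (h₁₀ : b₁ < a₀) (h₁ : a₁ < b₁) (r s t : unitInterval) :
    edist (levelEval f a₀ b₀ a₁ b₁ s (r, γ)) (levelEval f a₀ b₀ a₁ b₁ t (r, γ)) =
      ENNReal.ofReal |(s : ℝ) - t| *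
        edist (levelEval f a₀ b₀ a₁ b₁ 0 (r, γ)) (levelEval f a₀ b₀ a₁ b₁ 1 (r, γ)) := by
  rw [edist_dist, edist_dist, h.dist_levelEval h₀ h₁₀ h₁, h.dist_levelEval h₀ h₁₀ h₁, levelAt_sub,
    abs_mul, ENNReal.ofReal_mul (abs_nonneg _), abs_sub_comm]

theorem Crosses.edist_levelEval_le {f : X → ℝ} {γ : Geod X} (h : Crosses f γ a₁ b₀) (h₀ : a₀ < b₀)
    (h₁₀ : b₁ < a₀) (h₁ : a₁ < b₁) (r s t : unitInterval) :
    edist (levelEval f a₀ b₀ a₁ b₁ s (r, γ)) (levelEval f a₀ b₀ a₁ b₁ t (r, γ)) ≤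
      ENNReal.ofReal (b₀ - a₁) := by
  rw [edist_dist, h.dist_levelEval h₀ h₁₀ h₁]
  have hs := levelAt_mem_Icc h₀ h₁₀ h₁ s r
  have ht := levelAt_mem_Icc h₀ h₁₀ h₁ t r
  exact ENNReal.ofReal_le_ofReal (abs_le.2 ⟨by linarith [hs.1, ht.2], by linarith [hs.2, ht.1]⟩)

/-- The quadratic potentials composed with `f` bound d² from below, with equality on `S`, and their
sum is insensitive to permutations. -/
theorem isSqCyclicallyMonotone_levels {f : X → ℝ} (hf : LipschitzWith 1 f) {a₀ b₀ a₁ b₁ : ℝ}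
    (h₀ : a₀ < b₀) (h₁ : a₁ < b₁) {S : Set (X × X)}
    (hS : ∀ p ∈ S, ∃ s : ℝ, f p.1 = b₀ - s * (b₀ - a₀) ∧ f p.2 = b₁ - s * (b₁ - a₁) ∧
      dist p.1 p.2 = |f p.1 - f p.2|) : IsSqCyclicallyMonotone S := by
  obtain ⟨F, G, -, -, hle, heq⟩ :=
    exists_quadratic_potentials b₀ b₁ (sub_pos.2 h₀) (sub_pos.2 h₁)
  intro n x y hxy σ
  calc ∑ i, dist (x i) (y i) ^ 2 = ∑ i, (F (f (x i)) + G (f (y i))) := by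
        refine Finset.sum_congr rfl fun i _ => ?_
        obtain ⟨s, h1, h2, h3⟩ := hS _ (hxy i)
        simp only at h1 h2 h3
        rw [h3, sq_abs, h1, h2, heq]
    _ = ∑ i, (F (f (x i)) + G (f (y (σ i)))) := by
        rw [Finset.sum_add_distrib, Finset.sum_add_distrib, Equiv.sum_comp σ fun i => G (f (y i))]
    _ ≤ ∑ i, dist (x i) (y (σ i)) ^ 2 := by
        refine Finset.sum_le_sum fun i _ => (hle _ _).trans ?_
        have := hf.dist_le_mul (x i) (y (σ i))
        rw [NNReal.coe_one, one_mul, Real.dist_eq] at this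
        exact sq_le_sq' (by linarith [neg_abs_le (f (x i) - f (y (σ i)))])
          ((le_abs_self _).trans this)

variable [TopologicalSpace.SeparableSpace X]

theorem measurable_levelMap {f : X → ℝ} (hf : Continuous f) (t : unitInterval) :
    Measurable (levelMap f a₀ b₀ a₁ b₁ t) := by
  have : SecondCountableTopology X := UniformSpace.secondCountable_of_separable X
  have h1 : Continuous fun p : unitInterval × Geod X => f (p.2.1 0) := by fun_prop
  have h2 : Continuous fun p : unitInterval × Geod X => dist (p.2.1 0) (p.2.1 1) := by fun_prop
  have h3 : Continuous fun p : unitInterval × Geod X => levelAt a₀ b₀ a₁ b₁ t p.1 := by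
    unfold levelAt
    fun_prop
  exact (continuous_projIcc.measurable.comp
    ((h1.measurable.sub h3.measurable).div h2.measurable)).prodMk measurable_snd

theorem measurable_evalMap [MeasurableSpace X] [BorelSpace X] : Measurable (evalMap X) := by
  have : SecondCountableTopology X := UniformSpace.secondCountable_of_separable X
  have : Continuous (evalMap X) := by
    unfold evalMap
    fun_prop
  exact this.measurable

/-- The measures `ν_t` are images of one product measure. -/
theorem nuCurve_eq_map {f : X → ℝ} (hf : Continuous f) (h₀ : a₀ < b₀)
    (h₁ : a₁ < b₁) {η : Measure (Geod X)} [IsProbabilityMeasure η] {H : Set (Geod X)}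
    (hη : ∀ᵐ γ ∂η, γ ∈ H) (hc₀ : ∀ γ ∈ H, Crosses f γ a₀ b₀) (hc₁ : ∀ γ ∈ H, Crosses f γ a₁ b₁)
    {R₀ L₀ R₁ L₁ : Geod X → ℝ} (hw₀ : ∀ γ ∈ H, IsTimeWindow f γ a₀ b₀ (R₀ γ) (L₀ γ))
    (hw₁ : ∀ γ ∈ H, IsTimeWindow f γ a₁ b₁ (R₁ γ) (L₁ γ)) (t : unitInterval) :
    nuCurve η H R₀ L₀ R₁ L₁ t =
      ((volume : Measure unitInterval).prod η).map (levelMap f a₀ b₀ a₁ b₁ t) := by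
  rw [nuCurve, Measure.restrict_eq_self_of_ae_mem hη, ← bind_map_prodMk (measurable_levelMap hf t)]
  -- Only almost everywhere equality of the fibres is needed, so `R₀`, `L₀`, `R₁`, `L₁` need not be
  -- measurable off `H`.
  refine Measure.bind_congr_right ?_
  filter_upwards [hη] with γ hγ
  have hl := (hc₀ γ hγ).dist_pos
  obtain ⟨hR₀, hL₀⟩ := ((hc₀ γ hγ).isTimeWindow_iff h₀).1 (hw₀ γ hγ)
  obtain ⟨hR₁, hL₁⟩ := ((hc₁ γ hγ).isTimeWindow_iff h₁).1 (hw₁ γ hγ)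
  have hR : interp t (R₀ γ) (R₁ γ) = (f (γ.1 0) - interp t b₀ b₁) / dist (γ.1 0) (γ.1 1) := by
    rw [hR₀, hR₁]; simp only [interp]; ring
  have hL : interp t (L₀ γ) (L₁ γ) = (interp t b₀ b₁ - interp t a₀ a₁) / dist (γ.1 0) (γ.1 1) := by
    rw [hL₀, hL₁]; simp only [interp]; ring
  have e1 := interp_mono (hc₀ γ hγ).le_start (hc₁ γ hγ).le_start t
  have e2 := interp_mono (hc₀ γ hγ).end_le (hc₁ γ hγ).end_le t
  rw [interp_self] at e1 e2
  have e3 := interp_lt_interp h₀ h₁ t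
  rw [fiberMeasure_eq_map]
  · congr 1
    funext s
    rw [hR, hL, levelMap, levelTime, levelAt]
    congr 2
    ring
  · rw [hR]; exact div_nonneg (by linarith) hl.le
  · rw [hL]; exact div_pos (by linarith) hl
  · rw [hR, hL, ← add_div, div_le_one hl]; linarith

end Interpolation

/-! ### The geodesic in Wasserstein space -/

section Curve

variable {X : Type*} [MetricSpace X] [TopologicalSpace.SeparableSpace X] [MeasurableSpace X]
  [BorelSpace X] {f : X → ℝ} {a₀ b₀ a₁ b₁ : ℝ} {η : Measure (Geod X)} [IsProbabilityMeasure η]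

theorem measurable_levelEval (hf : Continuous f) (t : unitInterval) :
    Measurable (levelEval f a₀ b₀ a₁ b₁ t) :=
  measurable_evalMap.comp (measurable_levelMap hf t)

theorem W2_map_levelEval (hf : LipschitzWith 1 f) (h₀ : a₀ < b₀) (h₁₀ : b₁ < a₀)
    (h₁ : a₁ < b₁) (hη : ∀ᵐ γ ∂η, Crosses f γ a₁ b₀) (s t : unitInterval) :
    W2 (((volume : Measure unitInterval).prod η).map (levelEval f a₀ b₀ a₁ b₁ s))
        (((volume : Measure unitInterval).prod η).map (levelEval f a₀ b₀ a₁ b₁ t)) =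
      (∫⁻ p, edist (levelEval f a₀ b₀ a₁ b₁ s p) (levelEval f a₀ b₀ a₁ b₁ t p) ^ 2
        ∂((volume : Measure unitInterval).prod η)) ^ (1 / 2 : ℝ) := by
  obtain ⟨F, G, hF, hG, hle, heq⟩ := exists_quadratic_potentials (interp s b₀ b₁) (interp t b₀ b₁)
    (sub_pos.2 (interp_lt_interp h₀ h₁ s)) (sub_pos.2 (interp_lt_interp h₀ h₁ t))
  have hη' : ∀ᵐ p ∂((volume : Measure unitInterval).prod η), Crosses f p.2 a₁ b₀ :=
    Measure.quasiMeasurePreserving_snd.ae hη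
  have hlevel : ∀ u : unitInterval, ∀ᵐ p ∂((volume : Measure unitInterval).prod η),
      f (levelEval f a₀ b₀ a₁ b₁ u p) = levelAt a₀ b₀ a₁ b₁ u p.1 := by
    intro u
    filter_upwards [hη'] with p hp using hp.apply_levelTime (levelAt_mem_Icc h₀ h₁₀ h₁ u p.1)
  have hint : ∀ (u : unitInterval) (K : ℝ → ℝ), Continuous K →
      Integrable (fun p => K (f (levelEval f a₀ b₀ a₁ b₁ u p)))
        ((volume : Measure unitInterval).prod η) := by
    intro u K hK
    have hc : Continuous fun r : unitInterval => K (levelAt a₀ b₀ a₁ b₁ u r) := by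
      unfold levelAt
      fun_prop
    have hi : Integrable (fun r : unitInterval => K (levelAt a₀ b₀ a₁ b₁ u r)) volume :=
      -- The level depends only on the relative time, which ranges over a compact interval.
      hc.integrable_of_hasCompactSupport (HasCompactSupport.of_compactSpace _)
    refine (hi.comp_fst η).congr ?_
    filter_upwards [hlevel u] with p hp
    rw [hp]
  refine W2_map_eq (F := fun x => F (f x)) (G := fun x => G (f x))
    (measurable_levelEval hf.continuous s) (measurable_levelEval hf.continuous t)
    (hF.comp hf.continuous).measurable (hG.comp hf.continuous).measurable ?_ ?_ (hint s F hF)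
    (hint t G hG)
  · intro x y
    refine (hle _ _).trans ?_
    have := hf.dist_le_mul x y
    rw [NNReal.coe_one, one_mul, Real.dist_eq] at this
    exact sq_le_sq' (by linarith [neg_abs_le (f x - f y)]) ((le_abs_self _).trans this)
  · filter_upwards [hη', hlevel s, hlevel t] with p hp hs ht
    rw [hs, ht, hp.dist_levelEval h₀ h₁₀ h₁, sq_abs]
    exact heq p.1

theorem isW2Geodesic_levelEval (hf : LipschitzWith 1 f) (h₀ : a₀ < b₀) (h₁₀ : b₁ < a₀)
    (h₁ : a₁ < b₁) (hη : ∀ᵐ γ ∂η, Crosses f γ a₁ b₀) :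
    IsW2Geodesic fun t =>
      ((volume : Measure unitInterval).prod η).map (levelEval f a₀ b₀ a₁ b₁ t) := by
  have hη' : ∀ᵐ p ∂((volume : Measure unitInterval).prod η), Crosses f p.2 a₁ b₀ :=
    Measure.quasiMeasurePreserving_snd.ae hη
  refine ⟨fun t => Measure.isProbabilityMeasure_map
    (measurable_levelEval hf.continuous t).aemeasurable, ?_, fun s t => ?_⟩
  · rw [W2_map_levelEval hf h₀ h₁₀ h₁ hη]
    refine ENNReal.rpow_ne_top_of_nonneg (by norm_num) (ne_top_of_le_ne_top
      (b := ENNReal.ofReal (b₀ - a₁) ^ 2) (by finiteness) ?_)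
    calc _ ≤ ∫⁻ _, ENNReal.ofReal (b₀ - a₁) ^ 2 ∂((volume : Measure unitInterval).prod η) := by
          refine lintegral_mono_ae ?_
          filter_upwards [hη'] with p hp
          gcongr
          exact hp.edist_levelEval_le h₀ h₁₀ h₁ p.1 0 1
      _ = _ := by simp
  · rw [W2_map_levelEval hf h₀ h₁₀ h₁ hη, W2_map_levelEval hf h₀ h₁₀ h₁ hη]
    have : ∫⁻ p, edist (levelEval f a₀ b₀ a₁ b₁ s p) (levelEval f a₀ b₀ a₁ b₁ t p) ^ 2
        ∂((volume : Measure unitInterval).prod η) = ENNReal.ofReal |(s : ℝ) - t| ^ 2 *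
        ∫⁻ p, edist (levelEval f a₀ b₀ a₁ b₁ 0 p) (levelEval f a₀ b₀ a₁ b₁ 1 p) ^ 2
          ∂((volume : Measure unitInterval).prod η) := by
      rw [← lintegral_const_mul' _ _ (by finiteness)]
      refine lintegral_congr_ae ?_
      filter_upwards [hη'] with p hp
      rw [hp.edist_levelEval h₀ h₁₀ h₁ p.1 s t, mul_pow]
    rw [this, ENNReal.mul_rpow_of_nonneg _ _ (by norm_num), ← ENNReal.rpow_natCast,
      ← ENNReal.rpow_mul]
    norm_num

/-- Every point moves by at most `b₀ - a₁`, so a second moment stays finite along the curve. -/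
theorem hasFiniteSecondMoment_levelEval (hf : LipschitzWith 1 f) (h₀ : a₀ < b₀) (h₁₀ : b₁ < a₀)
    (h₁ : a₁ < b₁) (hη : ∀ᵐ γ ∂η, Crosses f γ a₁ b₀) {s : unitInterval}
    (hs : HasFiniteSecondMoment
      (((volume : Measure unitInterval).prod η).map (levelEval f a₀ b₀ a₁ b₁ s)))
    (t : unitInterval) : HasFiniteSecondMoment
      (((volume : Measure unitInterval).prod η).map (levelEval f a₀ b₀ a₁ b₁ t)) := by
  have hη' : ∀ᵐ p ∂((volume : Measure unitInterval).prod η), Crosses f p.2 a₁ b₀ :=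
    Measure.quasiMeasurePreserving_snd.ae hη
  obtain ⟨x₀, hx₀⟩ := hs
  have hm : Measurable fun x : X => edist x x₀ ^ 2 := by fun_prop
  rw [lintegral_map hm (measurable_levelEval hf.continuous s)] at hx₀
  refine ⟨x₀, ?_⟩
  rw [lintegral_map hm (measurable_levelEval hf.continuous t)]
  calc _ ≤ ∫⁻ p, (2 * ENNReal.ofReal (b₀ - a₁) ^ 2 +
          2 * edist (levelEval f a₀ b₀ a₁ b₁ s p) x₀ ^ 2)
          ∂((volume : Measure unitInterval).prod η) := by
        refine lintegral_mono_ae ?_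
        filter_upwards [hη'] with p hp
        have h := (edist_triangle (levelEval f a₀ b₀ a₁ b₁ t p) (levelEval f a₀ b₀ a₁ b₁ s p)
          x₀).trans (add_le_add_left (hp.edist_levelEval_le h₀ h₁₀ h₁ p.1 t s) _)
        have h2 := ENNReal.rpow_add_le_mul_rpow_add_rpow (ENNReal.ofReal (b₀ - a₁))
          (edist (levelEval f a₀ b₀ a₁ b₁ s p) x₀) (p := 2) (by norm_num)
        norm_num at h2
        rw [← mul_add]
        exact (pow_le_pow_left₀ (by positivity) h 2).trans h2
    _ < ∞ := by
        rw [lintegral_add_left measurable_const,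
          lintegral_const_mul' 2 (fun p => edist (levelEval f a₀ b₀ a₁ b₁ s p) x₀ ^ 2)
            (by finiteness)]
        refine ENNReal.add_lt_top.2 ⟨?_, ENNReal.mul_lt_top (by finiteness) hx₀⟩
        rw [lintegral_const, measure_univ, mul_one]
        finiteness

theorem hasFiniteSecondMoment_levelEval_of_isCompact {f : X → ℝ} (hf : Continuous f)
    {K : Set (Geod X)} (hK : IsCompact K) (hη : ∀ᵐ γ ∂η, γ ∈ K) (t : unitInterval) :
    HasFiniteSecondMoment
      (((volume : Measure unitInterval).prod η).map (levelEval f a₀ b₀ a₁ b₁ t)) := by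
  obtain ⟨γ₀, -⟩ := hη.exists
  have hc : Continuous (evalMap X) := by
    unfold evalMap
    fun_prop
  obtain ⟨C, hC⟩ := ((isCompact_univ.prod hK).image hc).isBounded.subset_closedBall (γ₀.1 0)
  have hη' : ∀ᵐ p ∂((volume : Measure unitInterval).prod η), p.2 ∈ K :=
    Measure.quasiMeasurePreserving_snd.ae hη
  refine ⟨γ₀.1 0, ?_⟩
  rw [lintegral_map (by fun_prop) (measurable_levelEval hf t)]
  calc _ ≤ ∫⁻ _, ENNReal.ofReal C ^ 2 ∂((volume : Measure unitInterval).prod η) := by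
        refine lintegral_mono_ae ?_
        filter_upwards [hη'] with p hp
        gcongr
        rw [edist_dist]
        exact ENNReal.ofReal_le_ofReal (hC (mem_image_of_mem _ ⟨mem_univ _, hp⟩))
    _ < ∞ := by
        rw [lintegral_const, measure_univ, mul_one]
        finiteness

end Curve

/-! ### The main theorem -/

theorem proposition4 {X : Type*} [MetricSpace X] [CompleteSpace X]
    [TopologicalSpace.SeparableSpace X] [MeasurableSpace X] [BorelSpace X]
    (P : Measure (Geod X)) (hP : IsOptimalDynamicalPlan P)
    (φ : X → EReal)
    (hφ : IsKantorovichPotential φ (P.map fun γ => γ.1 0) (P.map fun γ => γ.1 1))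
    (a : ℝ) (φa : X → ℝ) (hφa : IsL1Potential φa (transportLevelSet φ a))
    (a₀ b₀ a₁ b₁ : ℝ) (h₀ : a₀ < b₀) (h₁₀ : b₁ < a₀) (h₁ : a₁ < b₁)
    (H : Set (Geod X)) (hH : H ⊆ levelGeod P φ a)
    (hH₀ : ∀ γ ∈ H, Ioo a₀ b₀ ⊆ (fun τ : unitInterval => φa (γ.1 τ)) '' Ioo 0 1)
    (hH₁ : ∀ γ ∈ H, Ioo a₁ b₁ ⊆ (fun τ : unitInterval => φa (γ.1 τ)) '' Ioo 0 1)
    (η : Measure (Geod X)) [IsProbabilityMeasure η]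
    (hHη : NullMeasurableSet H η) (hη : η H = 1) :
    -- the time windows exist and are unique
    (∀ γ ∈ H, (∃! p : ℝ × ℝ, IsTimeWindow φa γ a₀ b₀ p.1 p.2) ∧
      (∃! p : ℝ × ℝ, IsTimeWindow φa γ a₁ b₁ p.1 p.2)) ∧
    ∀ R₀ L₀ R₁ L₁ : Geod X → ℝ,
      (∀ γ ∈ H, IsTimeWindow φa γ a₀ b₀ (R₀ γ) (L₀ γ)) →
      (∀ γ ∈ H, IsTimeWindow φa γ a₁ b₁ (R₁ γ) (L₁ γ)) →
      -- each `ν_t` is a probability measure concentrated on `[0,1] × G_a`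
      (∀ t, IsProbabilityMeasure (nuCurve η H R₀ L₀ R₁ L₁ t) ∧
        ∀ᵐ p ∂(nuCurve η H R₀ L₀ R₁ L₁ t), p.2 ∈ levelGeod P φ a) ∧
      -- the points at equal relative times are `d²`-cyclically monotone
      IsSqCyclicallyMonotone
        {p : X × X | ∃ γ ∈ H, ∃ s τ₀ τ₁ : unitInterval,
          (τ₀ : ℝ) = R₀ γ + s * L₀ γ ∧ (τ₁ : ℝ) = R₁ γ + s * L₁ γ ∧ p = (γ.1 τ₀, γ.1 τ₁)} ∧
      -- `t ↦ e_♯ ν_t` is a `W₂`-geodesic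
      IsW2Geodesic (fun t => (nuCurve η H R₀ L₀ R₁ L₁ t).map (evalMap X)) ∧
      -- it lies in `𝒫₂(X)` as soon as `supp P` is compact or one of its measures is in `𝒫₂(X)`
      ((IsCompact P.support ∨
          ∃ t, HasFiniteSecondMoment ((nuCurve η H R₀ L₀ R₁ L₁ t).map (evalMap X))) →
        IsP2Geodesic fun t => (nuCurve η H R₀ L₀ R₁ L₁ t).map (evalMap X)) := by
  have hcont : Continuous φa := hφa.1.continuous
  have happ : ∀ γ ∈ H, ∀ t : unitInterval,
      φa (γ.1 t) = φa (γ.1 0) - t * dist (γ.1 0) (γ.1 1) := fun γ hγ =>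
    apply_geod_of_sub_eq_dist hφa.1
      (hφa.2 (γ.1 0, γ.1 1) ⟨hP.mem_contactSet hφ (hH hγ).1, (hH hγ).2⟩)
  have hc₀ : ∀ γ ∈ H, Crosses φa γ a₀ b₀ := fun γ hγ =>
    crosses_of_Ioo_subset h₀ (happ γ hγ) (hH₀ γ hγ)
  have hc₁ : ∀ γ ∈ H, Crosses φa γ a₁ b₁ := fun γ hγ =>
    crosses_of_Ioo_subset h₁ (happ γ hγ) (hH₁ γ hγ)
  -- The upper bound comes from the first window and the lower one from the second, so γ meets every
  -- interpolated level.
  have hc : ∀ γ ∈ H, Crosses φa γ a₁ b₀ := fun γ hγ =>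
    ⟨happ γ hγ, (hc₀ γ hγ).dist_pos, (hc₀ γ hγ).le_start, (hc₁ γ hγ).end_le⟩
  have hae : ∀ᵐ γ ∂η, γ ∈ H := (prob_compl_eq_zero_iff₀ hHη).2 hη
  refine ⟨fun γ hγ => ⟨(hc₀ γ hγ).existsUnique_isTimeWindow h₀,
    (hc₁ γ hγ).existsUnique_isTimeWindow h₁⟩, fun R₀ L₀ R₁ L₁ hw₀ hw₁ => ?_⟩
  have hnu := nuCurve_eq_map hcont h₀ h₁ hae hc₀ hc₁ hw₀ hw₁
  have hnuE : ∀ t, (nuCurve η H R₀ L₀ R₁ L₁ t).map (evalMap X) =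
      ((volume : Measure unitInterval).prod η).map (levelEval φa a₀ b₀ a₁ b₁ t) := fun t => by
    rw [hnu, Measure.map_map measurable_evalMap (measurable_levelMap hcont t)]
    rfl
  have haec : ∀ᵐ γ ∂η, Crosses φa γ a₁ b₀ := hae.mono hc
  have hgeo := isW2Geodesic_levelEval hφa.1 h₀ h₁₀ h₁ haec
  simp only [hnuE]
  refine ⟨fun t => ?_, ?_, hgeo, ?_⟩
  · rw [hnu]
    refine ⟨Measure.isProbabilityMeasure_map (measurable_levelMap hcont t).aemeasurable, ?_⟩
    -- `levelMap` keeps the geodesic, so the second marginal of `ν_t` is `η`.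
    have hmap : (((volume : Measure unitInterval).prod η).map
        (levelMap φa a₀ b₀ a₁ b₁ t)).map Prod.snd = η := by
      rw [Measure.map_map measurable_snd (measurable_levelMap hcont t)]
      exact measurePreserving_snd.map_eq
    refine ae_of_ae_map measurable_snd.aemeasurable (p := fun γ => γ ∈ levelGeod P φ a) ?_
    rw [hmap]
    exact hae.mono fun γ hγ => hH hγ
  · refine isSqCyclicallyMonotone_levels hφa.1 h₀ h₁ ?_
    rintro _ ⟨γ, hγ, s, τ₀, τ₁, hτ₀, hτ₁, rfl⟩
    have hl := (hc γ hγ).dist_pos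
    obtain ⟨hR₀, hL₀⟩ := ((hc₀ γ hγ).isTimeWindow_iff h₀).1 (hw₀ γ hγ)
    obtain ⟨hR₁, hL₁⟩ := ((hc₁ γ hγ).isTimeWindow_iff h₁).1 (hw₁ γ hγ)
    refine ⟨s, ?_, ?_, ?_⟩
    · simp only
      rw [happ γ hγ, hτ₀, hR₀, hL₀]
      field_simp
      ring
    · simp only
      rw [happ γ hγ, hτ₁, hR₁, hL₁]
      field_simp
      ring
    · simp only
      rw [happ γ hγ τ₀, happ γ hγ τ₁, γ.2 τ₀ τ₁, sub_sub_sub_cancel_left, ← sub_mul, abs_mul,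
        abs_of_pos hl, abs_sub_comm]
  · rintro (hK | ⟨s, hs⟩)
    · exact ⟨hgeo, hasFiniteSecondMoment_levelEval_of_isCompact hcont hK
        (hae.mono fun γ hγ => (hH hγ).1)⟩
    · exact ⟨hgeo, hasFiniteSecondMoment_levelEval hφa.1 h₀ h₁₀ h₁ haec hs⟩
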